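/- Let $\mathbb F=\mathbb R$ or $\mathbb C$, $n\ge 0$, and let $f:\mathbb F^{n\times n}\to\mathbb F^{n\times n}$ be continuous with $f(f(M))=M$, $f(M+N)=f(M)+f(N)$, $f(MN)=f(M)f(N)$ for all $M,N$, and $f(M)\ge 0$ whenever $M\ge 0$ (Loewner order). Let $A,Q\in\mathbb F^{n\times n}$ with $Q$ Hermitian, fix a sign $s\in\{+1,-1\}$, and consider the equation and its dual $$X+s\,A^Hf(X)^{-1}A=Q,\qquad (1)\qquad\qquad Y+s\,f(A)f(Y)^{-1}f(A)^H=Q.\qquad (2)$$ If $s=+1$, assume that there is a positive definite $X_S$ with $X_S\le Q-A^Hf(X_S)^{-1}A$. If $s=-1$, assume that $A$ is nonsingular and $Q$ is positive definite. Let $r\ge 2$ be an integer. Put $A^{(1)}=f(A)f(Q)^{-1}A$, $B^{(1)}=s\,f(A)f(Q)^{-1}f(A)^H$, $Q^{(1)}=Q-s\,A^Hf(Q)^{-1}A$. For $k=1,2,\dots$ put $(A_1,B_1,Q_1)=(A^{(k)},B^{(k)},Q^{(k)})$, for $i=1,\dots,r-1$ $$A_{i+1}=A^{(k)}(Q^{(k)}-B_i)^{-1}A_i,\quad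 B_{i+1}=B^{(k)}+A^{(k)}(Q^{(k)}-B_i)^{-1}(A^{(k)})^H,\quad Q_{i+1}=Q_i-A_i^H(Q^{(k)}-B_i)^{-1}A_i,$$ and $(A^{(k+1)},B^{(k+1)},Q^{(k+1)})=(A_r,B_r,Q_r)$. Then this iteration is well defined (all the matrices to be inverted, $f(Q)$ and every $Q^{(k)}-B_i$ with $k\ge1$, $1\le i\le r-1$, are nonsingular). Equations (1) and (2) have maximal positive definite solutions $X_M$ and $Y_M$, respectively: each is a positive definite solution that is $\ge$ every Hermitian solution of its equation. Moreover, in the critical case $\rho(T_1)=1$, where $T_1=(X_M-B^{(1)})^{-1}A^{(1)}$ and $\rho$ is the spectral radius (over $\mathbb C$), $$A^{(k)}\to 0,\qquad Q^{(k)}\to X_M,\qquad B^{(k)}\to Q-Y_M,$$ each R-linearly with rate at least $1/r$; that is, for each of these sequences, written $Z_k\to Z$, there is $c>0$ with $\|Z_{k+1}-Z\|<c\,r^{-k}$ for all $k\ge 1$. -/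

import Mathlib

open Matrix
open scoped ComplexOrder

namespace MatrixEq

variable {𝕜 : Type*} [RCLike 𝕜] {n : ℕ}

/-- Square matrices of size `n` over `𝕜` (`ℝ` or `ℂ`). -/
abbrev Mat (𝕜 : Type*) (n : ℕ) : Type _ := Matrix (Fin n) (Fin n) 𝕜

/-- The standing assumptions on the matrix operator `f`: period two, additive, multiplicative
(order preserving), and preserving positive semidefiniteness. -/
structure IsAdmissible (f : Mat 𝕜 n → Mat 𝕜 n) : Prop where
  period_two : ∀ M, f (f M) = M
  map_add : ∀ M N, f (M + N) = f M + f N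
  map_mul : ∀ M N, f (M * N) = f M * f N
  map_nonneg : ∀ M, M.PosSemidef → (f M).PosSemidef

/-- The fixed-point map of the equation `X + s Aᴴ f(X)⁻¹ A = Q`; the sign `s` is `1` for the
plus equation and `-1` for the minus equation. -/
noncomputable def primalMap (s : ℤˣ) (f : Mat 𝕜 n → Mat 𝕜 n) (A Q X : Mat 𝕜 n) : Mat 𝕜 n :=
  Q - s • (Aᴴ * (f X)⁻¹ * A)

/-- The fixed-point map of the dual equation `Y + s f(A) f(Y)⁻¹ f(A)ᴴ = Q`. -/
noncomputable def dualMap (s : ℤˣ) (f : Mat 𝕜 n → Mat 𝕜 n) (A Q Y : Mat 𝕜 n) : Mat 𝕜 n :=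
  Q - s • (f A * (f Y)⁻¹ * (f A)ᴴ)

/-- `X` is a Hermitian solution of `X = F X`, where `F` is a map in which `f(X)⁻¹` occurs. -/
def IsSolution (f F : Mat 𝕜 n → Mat 𝕜 n) (X : Mat 𝕜 n) : Prop :=
  X.IsHermitian ∧ IsUnit (f X) ∧ X = F X

/-- `X` is the maximal positive definite solution of `X = F X`: it is above every Hermitian
solution in the Loewner order. -/
def IsMaximalSolution (f F : Mat 𝕜 n → Mat 𝕜 n) (X : Mat 𝕜 n) : Prop :=
  X.PosDef ∧ IsSolution f F X ∧ ∀ X', IsSolution f F X' → (X - X').PosSemidef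

/-- The set `S` of positive definite `X` with `X ≤ Q - Aᴴ f(X)⁻¹ A` (plus equation). -/
def subsolutions (f : Mat 𝕜 n → Mat 𝕜 n) (A Q : Mat 𝕜 n) : Set (Mat 𝕜 n) :=
  {X | X.PosDef ∧ (primalMap 1 f A Q X - X).PosSemidef}

/-- A triple `(A, B, Q)` of matrices. -/
@[ext] structure Triple (𝕜 : Type*) (n : ℕ) where
  A : Mat 𝕜 n
  B : Mat 𝕜 n
  Q : Mat 𝕜 n

/-- The initial triple `(A⁽¹⁾, B⁽¹⁾, Q⁽¹⁾)`. -/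
noncomputable def initial (s : ℤˣ) (f : Mat 𝕜 n → Mat 𝕜 n) (A Q : Mat 𝕜 n) : Triple 𝕜 n where
  A := f A * (f Q)⁻¹ * A
  B := s • (f A * (f Q)⁻¹ * (f A)ᴴ)
  Q := Q - s • (Aᴴ * (f Q)⁻¹ * A)

/-- One step of the iteration applied to the current triple `Y`, with constant matrices `C`. -/
noncomputable def step (C Y : Triple 𝕜 n) : Triple 𝕜 n where
  A := C.A * (C.Q - Y.B)⁻¹ * Y.A
  B := C.B + C.A * (C.Q - Y.B)⁻¹ * C.Aᴴ
  Q := Y.Q - Y.Aᴴ * (C.Q - Y.B)⁻¹ * Y.A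

/-- The inner loop started at the outer iterate `C = (Â⁽ᵏ⁾, B̂⁽ᵏ⁾, Q̂⁽ᵏ⁾)`. The value at `i` is
the triple `(A_{i+1}(k), B_{i+1}(k), Q_{i+1}(k))`, so the value at `0` is `C` itself. -/
noncomputable def inner (C : Triple 𝕜 n) : ℕ → Triple 𝕜 n
  | 0 => C
  | i + 1 => step C (inner C i)

/-- The accelerated iteration of order `r` (`r ≥ 2`). The value at `k` is the outer iterate
`(Â⁽ᵏ⁺¹⁾, B̂⁽ᵏ⁺¹⁾, Q̂⁽ᵏ⁺¹⁾)`, so the value at `0` is the initial triple; each outer iterate is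
one step applied to the inner triple with subscript `r - 1`. -/
noncomputable def accel (s : ℤˣ) (f : Mat 𝕜 n → Mat 𝕜 n) (A Q : Mat 𝕜 n) (r : ℕ) :
    ℕ → Triple 𝕜 n
  | 0 => initial s f A Q
  | k + 1 => step (accel s f A Q r k) (inner (accel s f A Q r k) (r - 2))

/-- The accelerated iteration never breaks down: every matrix that it inverts, namely `f(Q)` in
the initial triple and `Q̂⁽ᵏ⁾ - B_i(k)` for `k ≥ 1` and `1 ≤ i ≤ r - 1`, is nonsingular. -/
def WellDefined (s : ℤˣ) (f : Mat 𝕜 n → Mat 𝕜 n) (A Q : Mat 𝕜 n) (r : ℕ) : Prop :=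
  IsUnit (f Q) ∧ ∀ k i, i < r - 1 →
    IsUnit ((accel s f A Q r k).Q - (inner (accel s f A Q r k) i).B)

/-- `T₁ = (X_M - B⁽¹⁾)⁻¹ A⁽¹⁾`. -/
noncomputable def closedLoop (s : ℤˣ) (f : Mat 𝕜 n → Mat 𝕜 n) (A Q XM : Mat 𝕜 n) : Mat 𝕜 n :=
  (XM - (initial s f A Q).B)⁻¹ * (initial s f A Q).A

/-- The spectral radius of a matrix over `𝕜`, computed from its complex eigenvalues
(also when `𝕜 = ℝ`). -/
noncomputable def specRadius (M : Mat 𝕜 n) : ENNReal :=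
  spectralRadius ℂ (M.map (RCLike.map 𝕜 ℂ))

open scoped Matrix.Norms.L2Operator in
/-- R-linear convergence `X⁽ᵏ⁾ → L` with rate `σ`: `‖X⁽ᵏ⁺¹⁾ - L‖ < c σᵏ` for all `k ≥ 1`, for some
`c > 0`, where `0 < σ < 1`. The argument is the shifted sequence `X k = X⁽ᵏ⁺¹⁾`. The norm is
the spectral norm; all norms on matrices are equivalent, so the notion does not depend on it. -/
def ConvergesRLinearly (X : ℕ → Mat 𝕜 n) (L : Mat 𝕜 n) (σ : ℝ) : Prop :=
  0 < σ ∧ σ < 1 ∧ ∃ c : ℝ, 0 < c ∧ ∀ k : ℕ, 1 ≤ k → ‖X k - L‖ < c * σ ^ k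

end MatrixEq

namespace MatrixEq

open scoped MatrixOrder
open Filter Topology

variable {𝕜 : Type*} [RCLike 𝕜] {n : ℕ}

/-! Write F for `primalMap`. By the Woodbury identity and f ∘ f = id, F ∘ F no longer involves f or
the sign: in the variable D = X - B⁽¹⁾ it is the map D ↦ R - A₁ᴴ D⁻¹ A₁ with A₁ = A⁽¹⁾ and R = Q⁽¹⁾
- B⁽¹⁾ (`primalMap_primalMap`). A subsolution of F ∘ F makes the monotone iteration from R converge
to the maximal solution D (`exists_isStdMax`). The corresponding M is maximal for F ∘ F, so F M ≤ M.
Equality follows from monotonicity of F if s = 1, and from a contraction argument on two-cycles if s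
= -1 (`le_of_two_cycle`). The dual equation is treated alike; for s = 1 its subsolution comes from
`exists_dual_std_solution`.

Put T = D⁻¹ A₁, K_m = ∑_{j<m} Tʲ D⁻¹ (Tʲ)ᴴ and gap_m = (Tᵐ)ᴴ K_m⁻¹ Tᵐ. The triples (K_m⁻¹ Tᵐ, X -
K_m⁻¹, X + gap_m) contain the initial triple at m = 1, and a step adds indices (`step_iterTriple`).
Hence `accel` at k is the triple of index rᵏ, and each pivot K_b⁻¹ + gap_a is positive definite.

It remains to see gap_m = O(1/m) (`trace_gap_le`). The iteration from R is D + gap_m and tends to D,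
so gap_m → 0, which forces the eigenvalues of T into the closed unit disc. For such T every orbit
term is at most a constant times the mean of the earlier ones (`norm_pow_apply_le_mean`), and
Cauchy–Schwarz against K_m turns this into the rate, without Jordan forms. This settles Q; duality
settles B; and A is bounded by the geometric mean of an increment of B and a decrement of Q
(`norm_mul_mul_sq_le`). -/

/-! ### Quadratic forms, the Loewner order and Schur complements. -/

/-- The real quadratic form `re (vᴴ M v)`. -/
noncomputable def quad (M : Mat 𝕜 n) (v : Fin n → 𝕜) : ℝ := RCLike.re (star v ⬝ᵥ M *ᵥ v)

theorem quad_add (M N : Mat 𝕜 n) (v : Fin n → 𝕜) : quad (M + N) v = quad M v + quad N v := by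
  simp [quad, add_mulVec]

theorem quad_sub (M N : Mat 𝕜 n) (v : Fin n → 𝕜) : quad (M - N) v = quad M v - quad N v := by
  simp [quad, sub_mulVec]

theorem quad_conj (M C : Mat 𝕜 n) (v : Fin n → 𝕜) : quad (Cᴴ * M * C) v = quad M (C *ᵥ v) := by
  simp [quad, star_mulVec, ← dotProduct_mulVec, mulVec_mulVec, Matrix.mul_assoc]

theorem quad_zero_right (M : Mat 𝕜 n) : quad M 0 = 0 := by simp [quad]

theorem quad_smul_right (M : Mat 𝕜 n) (c : 𝕜) (v : Fin n → 𝕜) :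
    quad M (c • v) = ‖c‖ ^ 2 * quad M v := by
  have : star (c • v) ⬝ᵥ M *ᵥ (c • v) = ((‖c‖ ^ 2 : ℝ) : 𝕜) * (star v ⬝ᵥ M *ᵥ v) := by
    rw [star_smul, mulVec_smul, smul_dotProduct, dotProduct_smul, smul_eq_mul, smul_eq_mul,
      ← mul_assoc, RCLike.star_def, RCLike.conj_mul]
    push_cast; rfl
  rw [quad, this, RCLike.re_ofReal_mul, quad]

theorem quad_nonneg {M : Mat 𝕜 n} (hM : 0 ≤ M) (v : Fin n → 𝕜) : 0 ≤ quad M v :=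
  hM.posSemidef.re_dotProduct_nonneg v

theorem quad_mono {M N : Mat 𝕜 n} (h : M ≤ N) (v : Fin n → 𝕜) : quad M v ≤ quad N v := by
  have := quad_nonneg (sub_nonneg.2 h) v
  rw [quad_sub] at this; linarith

theorem nonneg_of_quad {M : Mat 𝕜 n} (hM : M.IsHermitian) (h : ∀ v, 0 ≤ quad M v) : 0 ≤ M := by
  rw [nonneg_iff_posSemidef]
  refine .of_dotProduct_mulVec_nonneg hM fun v => ?_
  rw [RCLike.nonneg_iff]
  exact ⟨h v, hM.im_star_dotProduct_mulVec_self v⟩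

theorem conj_nonneg {M : Mat 𝕜 n} (h : 0 ≤ M) (C : Mat 𝕜 n) : 0 ≤ Cᴴ * M * C :=
  (h.posSemidef.conjTranspose_mul_mul_same C).nonneg

theorem conj_nonneg' {M : Mat 𝕜 n} (h : 0 ≤ M) (C : Mat 𝕜 n) : 0 ≤ C * M * Cᴴ :=
  (h.posSemidef.mul_mul_conjTranspose_same C).nonneg

theorem conj_mono {M N : Mat 𝕜 n} (h : M ≤ N) (C : Mat 𝕜 n) : Cᴴ * M * C ≤ Cᴴ * N * C := by
  have := conj_nonneg (sub_nonneg.2 h) C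
  rw [mul_sub, sub_mul] at this
  exact sub_nonneg.1 this

theorem nonneg_of_posDef {M : Mat 𝕜 n} (h : M.PosDef) : 0 ≤ M := h.posSemidef.nonneg

theorem posDef_of_le {M N : Mat 𝕜 n} (hM : M.PosDef) (h : M ≤ N) : N.PosDef := by
  have := hM.add_posSemidef (le_iff.1 h)
  rwa [add_sub_cancel] at this

theorem posDef_of_nonneg {M : Mat 𝕜 n} (h : 0 ≤ M) (hu : IsUnit M) : M.PosDef :=
  h.posSemidef.posDef_iff_isUnit.2 hu

theorem isHermitian_of_nonneg {M : Mat 𝕜 n} (h : 0 ≤ M) : M.IsHermitian := h.posSemidef.1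

theorem mul_inv_of_isUnit {M : Mat 𝕜 n} (h : IsUnit M) : M * M⁻¹ = 1 :=
  mul_nonsing_inv _ ((isUnit_iff_isUnit_det _).1 h)

theorem inv_mul_of_isUnit {M : Mat 𝕜 n} (h : IsUnit M) : M⁻¹ * M = 1 :=
  nonsing_inv_mul _ ((isUnit_iff_isUnit_det _).1 h)

theorem inv_inv_of_isUnit {M : Mat 𝕜 n} (h : IsUnit M) : M⁻¹⁻¹ = M :=
  nonsing_inv_nonsing_inv _ ((isUnit_iff_isUnit_det _).1 h)

theorem isUnit_of_mul_eq_one {M N : Mat 𝕜 n} (h : M * N = 1) : IsUnit M :=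
  (isUnit_iff_isUnit_det _).2 (isUnit_det_of_right_inverse h)

/-- Swapping the two Schur complements of a block matrix preserves positive semidefiniteness. -/
theorem schur_nonneg_iff {X N V : Mat 𝕜 n} (hX : X.PosDef) (hN : N.PosDef) :
    0 ≤ X - V * N⁻¹ * Vᴴ ↔ 0 ≤ N - Vᴴ * X⁻¹ * V := by
  have := hX.isUnit.invertible
  have := hN.isUnit.invertible
  rw [nonneg_iff_posSemidef, nonneg_iff_posSemidef, ← PosDef.fromBlocks₂₂ X V hN,
    PosDef.fromBlocks₁₁ V N hX]

/-- The inverse of a Schur complement. -/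
theorem schur_mul_inv {X N U V : Mat 𝕜 n} (hX : IsUnit X) (hN : IsUnit N)
    (hW : IsUnit (N - V * X⁻¹ * U)) :
    (X - U * N⁻¹ * V) * (X⁻¹ + X⁻¹ * U * (N - V * X⁻¹ * U)⁻¹ * V * X⁻¹) = 1 := by
  set W := N - V * X⁻¹ * U with hWd
  have h1 : V * X⁻¹ * U = N - W := by rw [hWd]; abel
  calc (X - U * N⁻¹ * V) * (X⁻¹ + X⁻¹ * U * W⁻¹ * V * X⁻¹)
      = X * X⁻¹ + X * X⁻¹ * U * W⁻¹ * V * X⁻¹ - U * N⁻¹ * V * X⁻¹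
        - U * N⁻¹ * (V * X⁻¹ * U) * W⁻¹ * V * X⁻¹ := by noncomm_ring
    _ = 1 + U * W⁻¹ * V * X⁻¹ - U * N⁻¹ * V * X⁻¹
        - (U * (N⁻¹ * N) * W⁻¹ * V * X⁻¹ - U * N⁻¹ * (W * W⁻¹) * V * X⁻¹) := by
        rw [h1, mul_inv_of_isUnit hX]; noncomm_ring
    _ = 1 := by
        rw [mul_inv_of_isUnit hW, inv_mul_of_isUnit hN]; noncomm_ring

theorem schur_isUnit {X N U V : Mat 𝕜 n} (hX : IsUnit X) (hN : IsUnit N)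
    (hW : IsUnit (N - V * X⁻¹ * U)) : IsUnit (X - U * N⁻¹ * V) :=
  isUnit_of_mul_eq_one (schur_mul_inv hX hN hW)

theorem schur_inv {X N U V : Mat 𝕜 n} (hX : IsUnit X) (hN : IsUnit N)
    (hW : IsUnit (N - V * X⁻¹ * U)) :
    (X - U * N⁻¹ * V)⁻¹ = X⁻¹ + X⁻¹ * U * (N - V * X⁻¹ * U)⁻¹ * V * X⁻¹ :=
  inv_eq_right_inv (schur_mul_inv hX hN hW)

theorem schur_posDef {X N V : Mat 𝕜 n} (hX : X.PosDef) (hN : N.PosDef)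
    (hW : (N - Vᴴ * X⁻¹ * V).PosDef) : (X - V * N⁻¹ * Vᴴ).PosDef :=
  posDef_of_nonneg ((schur_nonneg_iff hX hN).2 (nonneg_of_posDef hW))
    (schur_isUnit hX.isUnit hN.isUnit hW.isUnit)

/-- Y - X and X⁻¹ - Y⁻¹ are the two Schur complements of the block matrix with diagonal blocks Y,
X⁻¹ and off-diagonal blocks 1. -/
theorem inv_anti {X Y : Mat 𝕜 n} (hX : X.PosDef) (h : X ≤ Y) : Y⁻¹ ≤ X⁻¹ := by
  have := (schur_nonneg_iff (V := 1) (posDef_of_le hX h) hX.inv).1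
  rw [inv_inv_of_isUnit hX.isUnit] at this
  simpa using this (by simpa using h)

theorem exists_conjTranspose_mul_self {M : Mat 𝕜 n} (h : 0 ≤ M) : ∃ G : Mat 𝕜 n, M = Gᴴ * G := by
  obtain ⟨G, hG⟩ := CStarAlgebra.nonneg_iff_eq_star_mul_self.1 h
  exact ⟨G, hG⟩

theorem norm_dotProduct_sq_le (u w : Fin n → 𝕜) :
    ‖star u ⬝ᵥ w‖ ^ 2 ≤ RCLike.re (star u ⬝ᵥ u) * RCLike.re (star w ⬝ᵥ w) := by
  have h := norm_inner_le_norm (𝕜 := 𝕜) (WithLp.toLp 2 u) (WithLp.toLp 2 w)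
  have hn : ∀ x : Fin n → 𝕜, RCLike.re (star x ⬝ᵥ x) = ‖WithLp.toLp 2 x‖ ^ 2 := by
    intro x
    rw [← inner_self_eq_norm_sq (𝕜 := 𝕜), EuclideanSpace.inner_eq_star_dotProduct, dotProduct_comm]
  rw [hn, hn, ← mul_pow, dotProduct_comm]
  rw [EuclideanSpace.inner_eq_star_dotProduct] at h
  gcongr

/-- Cauchy–Schwarz for the pair of dual forms given by `K` and `K⁻¹`. -/
theorem norm_dotProduct_sq_le_quad {K : Mat 𝕜 n} (hK : K.PosDef) (u w : Fin n → 𝕜) :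
    ‖star u ⬝ᵥ w‖ ^ 2 ≤ quad K u * quad K⁻¹ w := by
  obtain ⟨G, hG⟩ := exists_conjTranspose_mul_self (nonneg_of_posDef hK)
  have h := norm_dotProduct_sq_le (G *ᵥ u) (G *ᵥ (K⁻¹ *ᵥ w))
  have h1 : star (G *ᵥ u) ⬝ᵥ G *ᵥ (K⁻¹ *ᵥ w) = star u ⬝ᵥ w := by
    rw [star_mulVec, ← dotProduct_mulVec, mulVec_mulVec, mulVec_mulVec, ← hG,
      mul_inv_of_isUnit hK.isUnit, one_mulVec]
  have h2 : ∀ x, RCLike.re (star (G *ᵥ x) ⬝ᵥ G *ᵥ x) = quad K x := by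
    intro x
    rw [star_mulVec, ← dotProduct_mulVec, mulVec_mulVec, ← hG, quad]
  have h3 : quad K (K⁻¹ *ᵥ w) = quad K⁻¹ w := by
    rw [← quad_conj, hK.inv.isHermitian.eq, inv_mul_of_isUnit hK.isUnit, Matrix.one_mul]
  rwa [h1, h2, h2, h3] at h

/-- Entries of Gᴴ G are inner products of columns of G, and the trace is the sum of their squared
norms. The trace thus serves as the size of a positive semidefinite matrix, both for monotone limits
and for rates. -/
theorem norm_entry_le_trace {M : Mat 𝕜 n} (h : 0 ≤ M) (i j : Fin n) :
    ‖M i j‖ ≤ RCLike.re M.trace := by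
  obtain ⟨G, rfl⟩ := exists_conjTranspose_mul_self h
  have htr : RCLike.re (Gᴴ * G).trace = ∑ l, ∑ k, ‖G k l‖ ^ 2 := by
    simp only [trace, diag_apply, mul_apply, conjTranspose_apply, map_sum, RCLike.star_def,
      RCLike.conj_mul]
    norm_cast
  have hcol : ∀ l, ∑ k, ‖G k l‖ ^ 2 ≤ RCLike.re (Gᴴ * G).trace := by
    intro l
    rw [htr]
    exact Finset.single_le_sum (f := fun l => ∑ k, ‖G k l‖ ^ 2) (fun _ _ => by positivity)
      (Finset.mem_univ l)
  calc ‖(Gᴴ * G) i j‖ ≤ ∑ k, ‖G k i‖ * ‖G k j‖ := by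
        rw [mul_apply]
        refine (norm_sum_le _ _).trans (Finset.sum_le_sum fun k _ => ?_)
        rw [norm_mul, conjTranspose_apply, norm_star]
    _ ≤ ∑ k, (‖G k i‖ ^ 2 + ‖G k j‖ ^ 2) / 2 :=
        Finset.sum_le_sum fun k _ => by nlinarith [sq_nonneg (‖G k i‖ - ‖G k j‖)]
    _ = (∑ k, ‖G k i‖ ^ 2 + ∑ k, ‖G k j‖ ^ 2) / 2 := by
        rw [← Finset.sum_div, Finset.sum_add_distrib]
    _ ≤ _ := by linarith [hcol i, hcol j]

theorem trace_re_mono {M N : Mat 𝕜 n} (h : M ≤ N) : RCLike.re M.trace ≤ RCLike.re N.trace := by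
  have := (RCLike.nonneg_iff.1 (le_iff.1 h).trace_nonneg).1
  rw [trace_sub, map_sub] at this; linarith

theorem isClosed_nonneg : IsClosed {M : Mat 𝕜 n | 0 ≤ M} := by
  have : {M : Mat 𝕜 n | 0 ≤ M} = {M | Mᴴ = M} ∩ ⋂ v, {M | 0 ≤ quad M v} := by
    ext M
    simp only [Set.mem_ofPred_eq, Set.mem_inter_iff, Set.mem_iInter]
    exact ⟨fun h => ⟨isHermitian_of_nonneg h, quad_nonneg h⟩, fun h => nonneg_of_quad h.1 h.2⟩
  rw [this]
  refine (isClosed_eq (by fun_prop) continuous_id).inter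
    (isClosed_iInter fun v => isClosed_le continuous_const ?_)
  unfold quad
  fun_prop

theorem le_of_tendsto_matrix {M N : ℕ → Mat 𝕜 n} {a b : Mat 𝕜 n} (hM : Tendsto M atTop (𝓝 a))
    (hN : Tendsto N atTop (𝓝 b)) (h : ∀ k, M k ≤ N k) : a ≤ b :=
  sub_nonneg.1 (isClosed_nonneg.mem_of_tendsto (hN.sub hM)
    (Eventually.of_forall fun k => sub_nonneg.2 (h k)))

/-- A decreasing sequence of positive semidefinite matrices converges. -/
theorem exists_tendsto_of_antitone {M : ℕ → Mat 𝕜 n} (hM : Antitone M) (h0 : ∀ k, 0 ≤ M k) :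
    ∃ L, Tendsto M atTop (𝓝 L) := by
  have ht : Antitone fun k => RCLike.re (M k).trace := fun i j hij => trace_re_mono (hM hij)
  have htc : CauchySeq fun k => RCLike.re (M k).trace :=
    (tendsto_atTop_ciInf ht ⟨0, by
      rintro _ ⟨k, rfl⟩
      simpa using trace_re_mono (h0 k)⟩).cauchySeq
  have hent : ∀ i j, ∃ l, Tendsto (fun k => M k i j) atTop (𝓝 l) := by
    intro i j
    refine cauchySeq_tendsto_of_complete (Metric.cauchySeq_iff'.2 fun ε hε => ?_)
    obtain ⟨N, hN⟩ := Metric.cauchySeq_iff'.1 htc ε hε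
    refine ⟨N, fun k hk => ?_⟩
    have h1 := norm_entry_le_trace (sub_nonneg.2 (hM hk)) i j
    have h2 := hN k hk
    rw [trace_sub, map_sub, Matrix.sub_apply] at h1
    rw [Real.dist_eq, abs_sub_comm] at h2
    rw [dist_comm, dist_eq_norm]
    exact h1.trans_lt ((le_abs_self _).trans_lt h2)
  choose l hl using hent
  exact ⟨of l, tendsto_pi_nhds.2 fun i => tendsto_pi_nhds.2 fun j => hl i j⟩

theorem tendsto_inv_matrix {M : ℕ → Mat 𝕜 n} {L : Mat 𝕜 n} (h : Tendsto M atTop (𝓝 L))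
    (hL : IsUnit L) : Tendsto (fun k => (M k)⁻¹) atTop (𝓝 L⁻¹) := by
  have hd : L.det ≠ 0 := ((isUnit_iff_isUnit_det _).1 hL).ne_zero
  have h1 : Tendsto (fun k => (M k).det) atTop (𝓝 L.det) :=
    ((continuous_id.matrix_det).tendsto L).comp h
  have h2 : Tendsto (fun k => (M k).adjugate) atTop (𝓝 L.adjugate) :=
    ((continuous_id.matrix_adjugate).tendsto L).comp h
  simp only [inv_def, Ring.inverse_eq_inv']
  exact (h1.inv₀ hd).smul h2

/-! ### The standard equation X + Aᴴ X⁻¹ A = R and its maximal solution. -/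

/-- The fixed-point map of the equation `X + Aᴴ X⁻¹ A = R`. -/
noncomputable def stdMap (A R X : Mat 𝕜 n) : Mat 𝕜 n := R - Aᴴ * X⁻¹ * A

theorem quad_completed_square {Z : Mat 𝕜 n} (hZ : Z.IsHermitian) (hu : IsUnit Z) (A : Mat 𝕜 n)
    (v u : Fin n → 𝕜) :
    quad Z (v + (Z⁻¹ * A) *ᵥ u) =
      quad Z v + 2 * RCLike.re (star v ⬝ᵥ A *ᵥ u) + quad (Aᴴ * Z⁻¹ * A) u := by
  have hZA : Z * (Z⁻¹ * A) = A := by rw [← Matrix.mul_assoc, mul_inv_of_isUnit hu, Matrix.one_mul]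
  have hAZ : (Z⁻¹ * A)ᴴ * Z = Aᴴ := by
    rw [conjTranspose_mul, hZ.inv.eq, Matrix.mul_assoc, inv_mul_of_isUnit hu, Matrix.mul_one]
  have e1 : star ((Z⁻¹ * A) *ᵥ u) ⬝ᵥ Z *ᵥ v = star (star v ⬝ᵥ A *ᵥ u) := by
    rw [star_mulVec, ← dotProduct_mulVec, mulVec_mulVec, hAZ, ← star_dotProduct_star, star_star,
      star_mulVec, ← dotProduct_mulVec]
  have e2 : star ((Z⁻¹ * A) *ᵥ u) ⬝ᵥ Z *ᵥ ((Z⁻¹ * A) *ᵥ u) = star u ⬝ᵥ (Aᴴ * Z⁻¹ * A) *ᵥ u := by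
    rw [star_mulVec, ← dotProduct_mulVec, mulVec_mulVec, mulVec_mulVec, hAZ, Matrix.mul_assoc]
  have e3 : star v ⬝ᵥ Z *ᵥ ((Z⁻¹ * A) *ᵥ u) = star v ⬝ᵥ A *ᵥ u := by
    rw [mulVec_mulVec, hZA]
  simp only [quad, mulVec_add, star_add, add_dotProduct, dotProduct_add, map_add, e1, e2, e3,
    RCLike.star_def, RCLike.conj_re]
  ring

/-- If `X + Aᴴ X⁻¹ A ≤ R` has a positive definite solution, then every Hermitian solution of the
equation is positive semidefinite. -/
theorem std_solution_nonneg {A R X₀ X : Mat 𝕜 n} (h₀ : X₀.PosDef) (hsub : X₀ ≤ stdMap A R X₀)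
    (hX : X.IsHermitian) (hu : IsUnit X) (hsol : X = stdMap A R X) : 0 ≤ X := by
  refine nonneg_of_quad hX fun w => ?_
  set S : Mat 𝕜 n := -(X⁻¹ * A) with hS
  -- The V j are the Horner partial evaluations of the characteristic polynomial at S: they start at
  -- 1, satisfy V (j+1) = c (j+1) + S V j, and end at V n = 0 by Cayley–Hamilton.
  set c : ℕ → 𝕜 := fun i => S.charpoly.coeff (n - i) with hc
  set V : ℕ → Mat 𝕜 n := fun j => ∑ i ∈ Finset.range (j + 1), c i • S ^ (j - i) with hV
  have hV0 : V 0 = 1 := by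
    have : S.charpoly.coeff n = 1 := by
      have h1 := S.charpoly_monic.coeff_natDegree
      rwa [charpoly_natDegree_eq_dim, Fintype.card_fin] at h1
    simp [hV, hc, this]
  have hVs : ∀ j, V (j + 1) = c (j + 1) • 1 + S * V j := by
    intro j
    simp only [hV]
    rw [Finset.sum_range_succ, add_comm, Finset.mul_sum]
    congr 1
    · simp
    · refine Finset.sum_congr rfl fun i hi => ?_
      rw [mul_smul_comm, ← pow_succ', Nat.succ_sub (Finset.mem_range_succ_iff.1 hi)]
  have hVn : V n = 0 := by
    have h1 := S.aeval_self_charpoly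
    rw [Polynomial.aeval_eq_sum_range' (n := n + 1)
      (by rw [charpoly_natDegree_eq_dim, Fintype.card_fin]; exact Nat.lt_succ_self n)] at h1
    rw [← h1, ← Finset.sum_range_reflect]
    refine Finset.sum_congr rfl fun i hi => ?_
    simp [hc]
  -- Subtract the completed squares of X and X₀: the cross terms cancel, the square for X₀ is
  -- nonnegative, and R drops out by the equation for X and the inequality for X₀. Along v = V (j+1)
  -- w, u = V j w the right side is ‖c (j+1)‖² times the form at w, so the sum telescopes.
  have key : ∀ v u, quad (X - X₀) v - quad (X - X₀) u ≤ quad X (v - S *ᵥ u) := by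
    intro v u
    have e1 := quad_completed_square hX hu A v u
    have e2 := quad_completed_square h₀.isHermitian h₀.isUnit A v u
    have p := quad_nonneg (nonneg_of_posDef h₀) (v + (X₀⁻¹ * A) *ᵥ u)
    have q := quad_mono hsub u
    have q' : quad X u = quad R u - quad (Aᴴ * X⁻¹ * A) u := by
      conv_lhs => rw [hsol]
      rw [stdMap, quad_sub]
    rw [stdMap, quad_sub] at q
    rw [hS, neg_mulVec, sub_neg_eq_add, quad_sub, quad_sub]
    linarith
  have tele : ∀ j, quad (X - X₀) (V j *ᵥ w) ≤
      (1 + ∑ i ∈ Finset.range j, ‖c (i + 1)‖ ^ 2) * quad X w := by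
    intro j
    induction j with
    | zero =>
      have := quad_nonneg (nonneg_of_posDef h₀) w
      simp [hV0, quad_sub, this]
    | succ j ih =>
      have h1 := key (V (j + 1) *ᵥ w) (V j *ᵥ w)
      have h2 : V (j + 1) *ᵥ w - S *ᵥ (V j *ᵥ w) = c (j + 1) • w := by
        rw [hVs, add_mulVec, mulVec_mulVec, add_sub_cancel_right, smul_mulVec, one_mulVec]
      rw [h2, quad_smul_right] at h1
      rw [Finset.sum_range_succ]
      linarith
  have := tele n
  rw [hVn, zero_mulVec, quad_zero_right] at this
  exact nonneg_of_mul_nonneg_right this (by positivity)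

theorem stdMap_mono {A R X Y : Mat 𝕜 n} (hX : X.PosDef) (h : X ≤ Y) :
    stdMap A R X ≤ stdMap A R Y :=
  sub_le_sub_left (conj_mono (inv_anti hX h) A) R

/-- The fixed-point iteration for `X + Aᴴ X⁻¹ A = R`, started at `R`. -/
noncomputable def stdSeq (A R : Mat 𝕜 n) : ℕ → Mat 𝕜 n
  | 0 => R
  | k + 1 => stdMap A R (stdSeq A R k)

theorem le_stdSeq {A R X₀ : Mat 𝕜 n} (h₀ : X₀.PosDef) (hsub : X₀ ≤ stdMap A R X₀) (k : ℕ) :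
    X₀ ≤ stdSeq A R k := by
  induction k with
  | zero => exact hsub.trans (sub_le_self _ (conj_nonneg (nonneg_of_posDef h₀.inv) A))
  | succ k ih => exact hsub.trans (stdMap_mono h₀ ih)

theorem stdSeq_antitone {A R X₀ : Mat 𝕜 n} (h₀ : X₀.PosDef) (hsub : X₀ ≤ stdMap A R X₀) :
    Antitone (stdSeq A R) := by
  have hp : ∀ k, (stdSeq A R k).PosDef := fun k => posDef_of_le h₀ (le_stdSeq h₀ hsub k)
  refine antitone_nat_of_succ_le fun k => ?_
  induction k with
  | zero => exact sub_le_self _ (conj_nonneg (nonneg_of_posDef (hp 0).inv) A)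
  | succ k ih => exact stdMap_mono (hp _) ih

/-- `X` is a positive definite solution of `X + Aᴴ X⁻¹ A = R` that is above every Hermitian
solution and is the limit of the fixed-point iteration. -/
structure IsStdMax (A R X : Mat 𝕜 n) : Prop where
  posDef : X.PosDef
  eq : X = stdMap A R X
  max : ∀ X' : Mat 𝕜 n, X'.IsHermitian → IsUnit X' → X' = stdMap A R X' → X' ≤ X
  tendsto : Tendsto (stdSeq A R) atTop (𝓝 X)

theorem exists_isStdMax {A R X₀ : Mat 𝕜 n} (h₀ : X₀.PosDef) (hsub : X₀ ≤ stdMap A R X₀) :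
    ∃ X, X₀ ≤ X ∧ IsStdMax A R X := by
  have hp : ∀ k, (stdSeq A R k).PosDef := fun k => posDef_of_le h₀ (le_stdSeq h₀ hsub k)
  obtain ⟨X, hX⟩ := exists_tendsto_of_antitone (stdSeq_antitone h₀ hsub)
    (fun k => nonneg_of_posDef (hp k))
  have h0X : X₀ ≤ X := le_of_tendsto_matrix tendsto_const_nhds hX (le_stdSeq h₀ hsub)
  have hXp := posDef_of_le h₀ h0X
  refine ⟨X, h0X, hXp, ?_, fun X' hH hu hs => ?_, hX⟩
  · have h1 : Tendsto (fun k => stdMap A R (stdSeq A R k)) atTop (𝓝 (stdMap A R X)) :=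
      tendsto_const_nhds.sub
        ((tendsto_const_nhds.mul (tendsto_inv_matrix hX hXp.isUnit)).mul tendsto_const_nhds)
    exact tendsto_nhds_unique ((tendsto_add_atTop_iff_nat 1).2 hX) h1
  -- Being positive definite, X' is itself a subsolution, hence lies below the whole iteration and
  -- below its limit.
  · have hX' := posDef_of_nonneg (std_solution_nonneg h₀ hsub hH hu hs) hu
    exact le_of_tendsto_matrix tendsto_const_nhds hX (le_stdSeq hX' hs.le)

theorem eq_add_of_eq_stdMap {A R D : Mat 𝕜 n} (h : D = stdMap A R D) : R = D + Aᴴ * D⁻¹ * A :=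
  eq_add_of_sub_eq h.symm

/-! ### Gram sums and the closed form of the fixed-point iteration. -/

/-- The partial sums `∑_{j<m} Tʲ D⁻¹ (Tʲ)ᴴ`. -/
noncomputable def gram (D T : Mat 𝕜 n) (m : ℕ) : Mat 𝕜 n :=
  ∑ j ∈ Finset.range m, T ^ j * D⁻¹ * (T ^ j)ᴴ

theorem gram_one (D T : Mat 𝕜 n) : gram D T 1 = D⁻¹ := by simp [gram]

theorem gram_add (D T : Mat 𝕜 n) (a b : ℕ) :
    gram D T (a + b) = gram D T a + T ^ a * gram D T b * (T ^ a)ᴴ := by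
  simp only [gram, Finset.sum_range_add, Finset.mul_sum, Finset.sum_mul, pow_add,
    conjTranspose_mul, Matrix.mul_assoc]

theorem gram_mono {D : Mat 𝕜 n} (hD : D.PosDef) (T : Mat 𝕜 n) : Monotone (gram D T) := by
  refine monotone_nat_of_le_succ fun m => ?_
  rw [gram_add, gram_one]
  exact le_add_of_nonneg_right (conj_nonneg' (nonneg_of_posDef hD.inv) _)

theorem gram_posDef {D : Mat 𝕜 n} (hD : D.PosDef) (T : Mat 𝕜 n) {m : ℕ} (hm : 1 ≤ m) :
    (gram D T m).PosDef :=
  posDef_of_le hD.inv (by simpa [gram_one] using gram_mono hD T hm)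

theorem quad_gram (D T : Mat 𝕜 n) (m : ℕ) (u : Fin n → 𝕜) :
    quad (gram D T m) u = ∑ j ∈ Finset.range m, quad D⁻¹ ((Tᴴ ^ j) *ᵥ u) := by
  induction m with
  | zero => simp [gram, quad]
  | succ m ih =>
    rw [gram_add, gram_one, quad_add, ih, Finset.sum_range_succ, ← quad_conj,
      ← conjTranspose_pow T, conjTranspose_conjTranspose]

/-- The deviation `(Tᵐ)ᴴ (∑_{j<m} Tʲ D⁻¹ (Tʲ)ᴴ)⁻¹ Tᵐ` of the iterates from the solution. -/
noncomputable def gap (D T : Mat 𝕜 n) (m : ℕ) : Mat 𝕜 n :=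
  (T ^ m)ᴴ * (gram D T m)⁻¹ * T ^ m

theorem gap_nonneg {D : Mat 𝕜 n} (hD : D.PosDef) (T : Mat 𝕜 n) {m : ℕ} (hm : 1 ≤ m) :
    0 ≤ gap D T m :=
  conj_nonneg (nonneg_of_posDef (gram_posDef hD T hm).inv) _

theorem inv_add_gap {D : Mat 𝕜 n} (hD : D.PosDef) (T : Mat 𝕜 n) {m : ℕ} (hm : 1 ≤ m) :
    (D + gap D T m)⁻¹ =
      D⁻¹ - D⁻¹ * (T ^ m)ᴴ * (gram D T (m + 1))⁻¹ * T ^ m * D⁻¹ := by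
  have h := schur_inv (X := D) (N := gram D T m) (U := -(T ^ m)ᴴ) (V := T ^ m) hD.isUnit
    (gram_posDef hD T hm).isUnit (by
      rw [mul_neg, sub_neg_eq_add]
      simpa [gram_add, gram_one] using (gram_posDef hD T (Nat.le_add_left 1 m)).isUnit)
  simp only [neg_mul, sub_neg_eq_add, mul_neg] at h
  rw [gap, h, gram_add, gram_one, sub_eq_add_neg]

/-- The index is shifted because the starting value R = D + Aᴴ D⁻¹ A already has deviation `gap` at
1. The inductive step is the Woodbury identity `inv_add_gap`. -/
theorem stdSeq_eq {A R D : Mat 𝕜 n} (hD : D.PosDef) (hsol : D = stdMap A R D) (k : ℕ) :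
    stdSeq A R k = D + gap D (D⁻¹ * A) (k + 1) := by
  have hR := eq_add_of_eq_stdMap hsol
  have hDi : D⁻¹ᴴ = D⁻¹ := hD.inv.isHermitian.eq
  induction k with
  | zero =>
    rw [stdSeq, gap, gram_one, zero_add, pow_one, inv_inv_of_isUnit hD.isUnit, conjTranspose_mul,
      hDi, Matrix.mul_assoc Aᴴ, inv_mul_of_isUnit hD.isUnit, Matrix.mul_one, hR]
    simp [Matrix.mul_assoc]
  | succ k ih =>
    rw [stdSeq, ih, stdMap, inv_add_gap hD _ (Nat.le_add_left 1 k), hR, gap,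
      pow_succ (D⁻¹ * A) (k + 1)]
    generalize (D⁻¹ * A) ^ (k + 1) = U
    rw [conjTranspose_mul, conjTranspose_mul, hDi]
    noncomm_ring

/-- Here it matters that D is the limit of the iteration and not just any solution; the bound on the
eigenvalues of T rests on this. -/
theorem gap_tendsto_zero {A R D : Mat 𝕜 n} (hD : IsStdMax A R D) :
    Tendsto (gap D (D⁻¹ * A)) atTop (𝓝 0) := by
  have h := hD.tendsto.sub_const D
  simp only [stdSeq_eq hD.posDef hD.eq, add_sub_cancel_left, sub_self] at h
  exact (tendsto_add_atTop_iff_nat 1).1 h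

/-! ### Solvability of the dual standard equation. -/

/-- Split off the first summand, K_{m+1} = D⁻¹ + T K_m Tᴴ, and apply Woodbury. In the limit this
recursion becomes the dual equation. -/
theorem gram_succ_inv {A D : Mat 𝕜 n} (hD : D.PosDef) {m : ℕ} (hm : 1 ≤ m) :
    (gram D (D⁻¹ * A) (m + 1))⁻¹ =
      D - A * ((gram D (D⁻¹ * A) m)⁻¹ + Aᴴ * D⁻¹ * A)⁻¹ * Aᴴ := by
  set K := gram D (D⁻¹ * A) m with hK
  have hKp : K.PosDef := gram_posDef hD _ hm
  have hDi : D⁻¹ᴴ = D⁻¹ := hD.inv.isHermitian.eq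
  have hTD : (D⁻¹ * A)ᴴ * D = Aᴴ := by
    rw [conjTranspose_mul, hDi, Matrix.mul_assoc, inv_mul_of_isUnit hD.isUnit, Matrix.mul_one]
  have hDT : D * (D⁻¹ * A) = A := by
    rw [← Matrix.mul_assoc, mul_inv_of_isUnit hD.isUnit, Matrix.one_mul]
  have hAA : Aᴴ * (D⁻¹ * A) = Aᴴ * D⁻¹ * A := by rw [Matrix.mul_assoc]
  have hW : (K⁻¹ + Aᴴ * D⁻¹ * A).PosDef :=
    posDef_of_le hKp.inv (le_add_of_nonneg_right (conj_nonneg (nonneg_of_posDef hD.inv) A))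
  have h := schur_inv (X := D⁻¹) (N := K⁻¹) (U := -(D⁻¹ * A)) (V := (D⁻¹ * A)ᴴ) hD.inv.isUnit
    hKp.inv.isUnit (by
      rw [inv_inv_of_isUnit hD.isUnit, hTD, mul_neg, sub_neg_eq_add, hAA]
      exact hW.isUnit)
  rw [inv_inv_of_isUnit hD.isUnit, inv_inv_of_isUnit hKp.isUnit, hTD, mul_neg, mul_neg,
    sub_neg_eq_add, hDT, hAA, Matrix.mul_assoc _ (D⁻¹ * A)ᴴ D, hTD, neg_mul, neg_mul,
    sub_neg_eq_add, neg_mul, neg_mul, ← sub_eq_add_neg] at h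
  rw [add_comm m 1, gram_add, gram_one, pow_one, h]

theorem quad_gram_le_of_pow_mulVec_eq_zero {D T : Mat 𝕜 n} (hD : D.PosDef) {u : Fin n → 𝕜} {l : ℕ}
    (hu : Tᴴ ^ l *ᵥ u = 0) (m : ℕ) : quad (gram D T m) u ≤ quad (gram D T l) u := by
  rcases le_total m l with h | h
  · exact quad_mono (gram_mono hD T h) u
  · refine le_of_eq ?_
    rw [quad_gram, quad_gram]
    refine (Finset.sum_subset (Finset.range_mono h) fun j _ hj => ?_).symm
    have hlj : l ≤ j := by simpa using hj
    rw [← Nat.sub_add_cancel hlj, pow_add, ← mulVec_mulVec, hu, mulVec_zero, quad_zero_right]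

theorem mulVec_eq_zero_of_quad {M : Mat 𝕜 n} (hM : 0 ≤ M) {v : Fin n → 𝕜} (h : quad M v = 0) :
    M *ᵥ v = 0 := by
  rw [← hM.posSemidef.dotProduct_mulVec_zero_iff]
  exact RCLike.ext (by simpa [quad] using h)
    (by simpa using hM.posSemidef.1.im_star_dotProduct_mulVec_self v)

/-- A projection onto the generalised kernel of `T`, as a polynomial in `T`. -/
theorem exists_mul_pow_eq_zero (T : Mat 𝕜 n) :
    ∃ (E : Mat 𝕜 n) (l : ℕ), E * T ^ l = 0 ∧ ∀ v, T *ᵥ v = 0 → E *ᵥ v = v := by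
  obtain ⟨g, hg, hg0⟩ :=
    Polynomial.exists_eq_pow_rootMultiplicity_mul_and_not_dvd T.charpoly T.charpoly_monic.ne_zero 0
  rw [map_zero, sub_zero] at hg hg0
  set l := T.charpoly.rootMultiplicity 0
  have hc : g.coeff 0 ≠ 0 := fun h => hg0 (Polynomial.X_dvd_iff.2 h)
  -- The characteristic polynomial is Xˡ g with g(0) ≠ 0, so g(T) Tˡ = 0 by Cayley–Hamilton, while
  -- g(T) acts as g(0) on the kernel of T.
  refine ⟨(g.coeff 0)⁻¹ • Polynomial.aeval T g, l, ?_, fun v hv => ?_⟩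
  · have h := T.aeval_self_charpoly
    rw [hg, mul_comm, map_mul, map_pow, Polynomial.aeval_X] at h
    rw [smul_mul_assoc, h, smul_zero]
  · have h : Polynomial.aeval T g *ᵥ v = g.coeff 0 • v := by
      conv_lhs => rw [← Polynomial.divX_mul_X_add g]
      rw [map_add, map_mul, Polynomial.aeval_X, Polynomial.aeval_C, add_mulVec, ← mulVec_mulVec, hv,
        mulVec_zero, zero_add, Algebra.algebraMap_eq_smul_one, smul_mulVec, one_mulVec]
    rw [smul_mulVec, h, smul_smul, inv_mul_cancel₀ hc, one_smul]

/-- If `X + Aᴴ X⁻¹ A = R` has a positive definite solution, so does `Y + A Y⁻¹ Aᴴ = R`. -/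
theorem exists_dual_std_solution {A R D : Mat 𝕜 n} (hD : D.PosDef) (hsol : D = stdMap A R D) :
    ∃ Y : Mat 𝕜 n, Y.PosDef ∧ Y = stdMap Aᴴ R Y := by
  have hR := eq_add_of_eq_stdMap hsol
  set T := D⁻¹ * A with hT
  set P : ℕ → Mat 𝕜 n := fun m => (gram D T (m + 1))⁻¹ with hP
  have hKp : ∀ m, (gram D T (m + 1)).PosDef := fun m => gram_posDef hD T (Nat.le_add_left 1 m)
  obtain ⟨L, hL⟩ := exists_tendsto_of_antitone (M := P)
    (fun a b hab => inv_anti (hKp a) (gram_mono hD T (Nat.add_le_add_right hab 1)))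
    (fun m => nonneg_of_posDef (hKp m).inv)
  have hL0 : 0 ≤ L := isClosed_nonneg.mem_of_tendsto hL
    (Eventually.of_forall fun m => nonneg_of_posDef (hKp m).inv)
  have hA0 : 0 ≤ Aᴴ * D⁻¹ * A := conj_nonneg (nonneg_of_posDef hD.inv) A
  set Y := L + Aᴴ * D⁻¹ * A with hY
  have hY0 : 0 ≤ Y := add_nonneg hL0 hA0
  have hYp : Y.PosDef := by
    refine .of_dotProduct_mulVec_pos (isHermitian_of_nonneg hY0) fun v hv => ?_
    refine (hY0.posSemidef.dotProduct_mulVec_nonneg v).lt_of_ne' fun h => hv ?_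
    have hq : quad Y v = 0 := by rw [quad, h, map_zero]
    rw [hY, quad_add] at hq
    have hqL := quad_nonneg hL0 v
    have hqA := quad_nonneg hA0 v
    have hTv : T *ᵥ v = 0 := by
      have h1 : quad D⁻¹ (A *ᵥ v) = 0 := by rw [← quad_conj]; linarith
      have h2 := mulVec_eq_zero_of_quad (nonneg_of_posDef hD.inv) h1
      rwa [mulVec_mulVec] at h2
    -- The vector Eᴴ v is killed by (Tᴴ)ˡ, so the Gram sums stay bounded on it, while its inner
    -- product with v is that of v with itself. Since the form of K_m⁻¹ at v tends to 0,
    -- Cauchy–Schwarz forces v = 0.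
    obtain ⟨E, l, hE, hEv⟩ := exists_mul_pow_eq_zero T
    have hul : Tᴴ ^ l *ᵥ (Eᴴ *ᵥ v) = 0 := by
      rw [← conjTranspose_pow, mulVec_mulVec, ← conjTranspose_mul, hE, conjTranspose_zero,
        zero_mulVec]
    have hbound : ∀ m, ‖star v ⬝ᵥ v‖ ^ 2 ≤ quad (gram D T l) (Eᴴ *ᵥ v) * quad (P m) v := by
      intro m
      have h1 := norm_dotProduct_sq_le_quad (hKp m) (Eᴴ *ᵥ v) v
      rw [star_mulVec, conjTranspose_conjTranspose, ← dotProduct_mulVec, hEv v hTv] at h1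
      exact h1.trans (mul_le_mul_of_nonneg_right
        (quad_gram_le_of_pow_mulVec_eq_zero hD hul _)
        (quad_nonneg (nonneg_of_posDef (hKp m).inv) v))
    have hlim : Tendsto (fun m => quad (gram D T l) (Eᴴ *ᵥ v) * quad (P m) v) atTop
        (𝓝 (quad (gram D T l) (Eᴴ *ᵥ v) * quad L v)) := by
      have hcont : Continuous fun M : Mat 𝕜 n => quad M v := by unfold quad; fun_prop
      exact ((hcont.tendsto L).comp hL).const_mul _
    have h3 := ge_of_tendsto' hlim hbound
    rw [show quad L v = 0 by linarith, mul_zero] at h3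
    have h4 : star v ⬝ᵥ v = 0 := norm_eq_zero.1 (by nlinarith [norm_nonneg (star v ⬝ᵥ v)])
    exact dotProduct_star_self_eq_zero.1 h4
  refine ⟨Y, hYp, ?_⟩
  have hrec : L = D - A * Y⁻¹ * Aᴴ := by
    have h1 : Tendsto (fun m => D - A * (P m + Aᴴ * D⁻¹ * A)⁻¹ * Aᴴ) atTop
        (𝓝 (D - A * Y⁻¹ * Aᴴ)) :=
      tendsto_const_nhds.sub ((tendsto_const_nhds.mul
        (tendsto_inv_matrix (hL.add_const _) hYp.isUnit)).mul tendsto_const_nhds)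
    refine tendsto_nhds_unique ((tendsto_add_atTop_iff_nat 1).2 hL) (h1.congr fun m => ?_)
    exact (gram_succ_inv hD (Nat.le_add_left 1 m)).symm
  rw [stdMap, conjTranspose_conjTranspose, hR]
  nth_rewrite 1 [hY]
  rw [hrec]
  abel

/-! ### Orbits of operators with spectrum in the closed unit disc. -/

section Recurrence

open Polynomial

variable {V : Type*} [NormedAddCommGroup V] [NormedSpace ℂ V]

/-- Subtracting from S^d u the mean of the terms z^(d-i) S^i u applies a polynomial divisible by X -
z, since X^d - z^(d-i) X^i is. This removes one root from the annihilating polynomial. -/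
theorem aeval_mean_apply (S : Module.End ℂ V) (p : ℂ[X]) (z : ℂ) (d : ℕ) (hd : d ≠ 0) (u : V)
    (hu : aeval S ((X - C z) * p) u = 0) :
    aeval S p ((S ^ d) u - (d : ℂ)⁻¹ • ∑ i ∈ Finset.range d, z ^ (d - i) • (S ^ i) u) = 0 := by
  set q : ℂ[X] := C (d : ℂ)⁻¹ * ∑ i ∈ Finset.range d, (X ^ d - C (z ^ (d - i)) * X ^ i) with hq
  have hd' : (d : ℂ) ≠ 0 := Nat.cast_ne_zero.2 hd
  have hdvd : X - C z ∣ q := by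
    refine Dvd.dvd.mul_left (Finset.dvd_sum fun i hi => ?_) _
    have hi' := (Finset.mem_range.1 hi).le
    have h1 : X ^ d - C (z ^ (d - i)) * X ^ i = (X ^ (d - i) - C z ^ (d - i)) * (X : ℂ[X]) ^ i := by
      rw [sub_mul, ← pow_add, Nat.sub_add_cancel hi', C_pow]
    rw [h1]
    exact (sub_dvd_pow_sub_pow _ _ _).mul_right _
  have hb : (S ^ d) u - (d : ℂ)⁻¹ • ∑ i ∈ Finset.range d, z ^ (d - i) • (S ^ i) u
      = aeval S q u := by
    rw [hq, map_mul, map_sum, aeval_C, Module.End.mul_apply, Module.algebraMap_end_apply]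
    simp only [map_sub, map_mul, map_pow, aeval_X, aeval_C, LinearMap.sum_apply, LinearMap.sub_apply,
      Finset.sum_sub_distrib, Finset.sum_const, Finset.card_range, smul_sub]
    congr 1
    · rw [← Nat.cast_smul_eq_nsmul ℂ, LinearMap.smul_apply, smul_smul, inv_mul_cancel₀ hd', one_smul]
    · refine congrArg _ (Finset.sum_congr rfl fun i _ => ?_)
      rw [← map_pow, Module.End.mul_apply, Module.algebraMap_end_apply]
  obtain ⟨g, hg⟩ := hdvd
  rw [hb, ← Module.End.mul_apply, ← map_mul, hg,
    show p * ((X - C z) * g) = g * ((X - C z) * p) by ring, map_mul, Module.End.mul_apply, hu,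
    map_zero]

/-- If all roots of an annihilating polynomial lie in the closed unit disc, then each term of the
orbit is controlled by the mean of the previous ones. -/
theorem norm_pow_apply_le_mean (S : Module.End ℂ V) (s : Multiset ℂ) (hs : ∀ z ∈ s, ‖z‖ ≤ 1) :
    ∃ (c : ℝ) (N : ℕ), 0 ≤ c ∧ ∀ m ≥ N, ∀ u : V, aeval S (s.map (X - C ·)).prod u = 0 →
      ‖(S ^ m) u‖ ≤ c / m * ∑ j ∈ Finset.range m, ‖(S ^ j) u‖ := by
  induction s using Multiset.induction_on with
  | empty =>
    refine ⟨0, 0, le_rfl, fun m _ u hu => ?_⟩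
    have : u = 0 := by simpa using hu
    simp [this]
  | cons z s ih =>
    obtain ⟨c, N, hc, h⟩ := ih fun w hw => hs w (Multiset.mem_cons_of_mem hw)
    have hz : ‖z‖ ≤ 1 := hs z (Multiset.mem_cons_self z s)
    -- Split m = d + l into near-halves: d terms form the mean removing the root z, and the
    -- induction hypothesis is used at l. The bounds 1/l ≤ 2/m and 1/d ≤ 3/m turn 2c/l + 1/d into
    -- (4c + 3)/m; m ≥ 2N + 2 ensures l ≥ N and d ≠ 0.
    refine ⟨4 * c + 3, 2 * N + 2, by positivity, fun m hm u hu => ?_⟩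
    obtain ⟨d, l, rfl, hd3, hl2, hd0, hl0, hlN⟩ : ∃ d l, m = d + l ∧ m ≤ 3 * d ∧ m ≤ 2 * l ∧
        d ≠ 0 ∧ l ≠ 0 ∧ N ≤ l := ⟨m / 2, m - m / 2, by omega, by omega, by omega, by omega,
          by omega, by omega⟩
    set a : ℕ → ℝ := fun j => ‖(S ^ j) u‖ with ha
    have ha0 : ∀ j, 0 ≤ a j := fun j => norm_nonneg _
    set b := (S ^ d) u - (d : ℂ)⁻¹ • ∑ i ∈ Finset.range d, z ^ (d - i) • (S ^ i) u with hb
    rw [Multiset.map_cons, Multiset.prod_cons] at hu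
    have hbl := h l hlN b (aeval_mean_apply S _ z d hd0 u hu)
    set T := ∑ j ∈ Finset.range (d + l), a j with hT
    have hT0 : 0 ≤ T := Finset.sum_nonneg fun j _ => ha0 j
    have hSb : ∀ j, (S ^ j) b =
        (S ^ (d + j)) u - (d : ℂ)⁻¹ • ∑ i ∈ Finset.range d, z ^ (d - i) • (S ^ (i + j)) u := by
      intro j
      simp only [hb, map_sub, map_smul, map_sum, ← Module.End.mul_apply, ← pow_add, add_comm j]
    have hmean : ∀ j, ‖(d : ℂ)⁻¹ • ∑ i ∈ Finset.range d, z ^ (d - i) • (S ^ (i + j)) u‖ ≤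
        (d : ℝ)⁻¹ * ∑ i ∈ Finset.range d, a (i + j) := by
      intro j
      rw [norm_smul, norm_inv, Complex.norm_natCast]
      refine mul_le_mul_of_nonneg_left ((norm_sum_le _ _).trans (Finset.sum_le_sum fun i _ => ?_))
        (by positivity)
      rw [norm_smul, norm_pow]
      exact mul_le_of_le_one_left (norm_nonneg _) (pow_le_one₀ (norm_nonneg _) hz)
    have hshift : ∀ i, i + l ≤ d + l → ∑ j ∈ Finset.range l, a (i + j) ≤ T := by
      intro i hi
      have h1 : ∑ j ∈ Finset.range l, a (i + j) ≤ ∑ j ∈ Finset.range (i + l), a j := by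
        rw [Finset.sum_range_add]
        exact le_add_of_nonneg_left (Finset.sum_nonneg fun j _ => ha0 j)
      exact h1.trans (Finset.sum_le_sum_of_subset_of_nonneg (Finset.range_mono hi)
        fun j _ _ => ha0 j)
    have hshift' : ∑ i ∈ Finset.range d, a (i + l) ≤ T := by
      have h1 : ∑ i ∈ Finset.range d, a (i + l) ≤ ∑ j ∈ Finset.range (l + d), a j := by
        rw [Finset.sum_range_add]
        simp only [add_comm l]
        exact le_add_of_nonneg_left (Finset.sum_nonneg fun j _ => ha0 j)
      rwa [add_comm l d] at h1
    have hdpos : (0 : ℝ) < d := by positivity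
    have hlpos : (0 : ℝ) < l := by positivity
    have hsumb : ∑ j ∈ Finset.range l, ‖(S ^ j) b‖ ≤ 2 * T := by
      calc ∑ j ∈ Finset.range l, ‖(S ^ j) b‖
          ≤ ∑ j ∈ Finset.range l, (a (d + j) + (d : ℝ)⁻¹ * ∑ i ∈ Finset.range d, a (i + j)) :=
            Finset.sum_le_sum fun j _ => by
              rw [hSb]
              exact (norm_sub_le _ _).trans (add_le_add le_rfl (hmean j))
        _ = ∑ j ∈ Finset.range l, a (d + j) +
              (d : ℝ)⁻¹ * ∑ i ∈ Finset.range d, ∑ j ∈ Finset.range l, a (i + j) := by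
            rw [Finset.sum_add_distrib, ← Finset.mul_sum, Finset.sum_comm]
        _ ≤ T + (d : ℝ)⁻¹ * ∑ i ∈ Finset.range d, T := by
            refine add_le_add (hshift d le_rfl) (mul_le_mul_of_nonneg_left
              (Finset.sum_le_sum fun i hi => hshift i ?_) (by positivity))
            have := Finset.mem_range.1 hi
            omega
        _ = 2 * T := by
            rw [Finset.sum_const, Finset.card_range, nsmul_eq_mul, inv_mul_cancel_left₀ hdpos.ne']
            ring
    have hmain : ‖(S ^ (d + l)) u‖ ≤ c / l * (2 * T) + (d : ℝ)⁻¹ * T := by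
      have h1 := hSb l
      have h2 : (S ^ (d + l)) u = (S ^ l) b +
          (d : ℂ)⁻¹ • ∑ i ∈ Finset.range d, z ^ (d - i) • (S ^ (i + l)) u := by
        rw [h1, sub_add_cancel]
      rw [h2]
      refine (norm_add_le _ _).trans (add_le_add (hbl.trans ?_) ((hmean l).trans ?_))
      · exact mul_le_mul_of_nonneg_left hsumb (by positivity)
      · exact mul_le_mul_of_nonneg_left hshift' (by positivity)
    have hm0 : (0 : ℝ) < (d + l : ℕ) := by positivity
    have e1 : c / l ≤ 2 * c / (d + l : ℕ) := by
      rw [div_le_div_iff₀ hlpos hm0]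
      have : ((d + l : ℕ) : ℝ) ≤ 2 * l := by exact_mod_cast hl2
      nlinarith
    have e2 : (d : ℝ)⁻¹ ≤ 3 / (d + l : ℕ) := by
      rw [inv_eq_one_div, div_le_div_iff₀ hdpos hm0]
      have : ((d + l : ℕ) : ℝ) ≤ 3 * d := by exact_mod_cast hd3
      linarith
    calc ‖(S ^ (d + l)) u‖ ≤ c / l * (2 * T) + (d : ℝ)⁻¹ * T := hmain
      _ ≤ 2 * c / (d + l : ℕ) * (2 * T) + 3 / (d + l : ℕ) * T := by gcongr
      _ = (4 * c + 3) / (d + l : ℕ) * T := by ring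

end Recurrence

theorem norm_pow_mulVec_le_mean (S : Mat ℂ n) (hS : ∀ z ∈ S.charpoly.roots, ‖z‖ ≤ 1) :
    ∃ (c : ℝ) (N : ℕ), 0 ≤ c ∧ ∀ m ≥ N, ∀ u : Fin n → ℂ,
      ‖S ^ m *ᵥ u‖ ≤ c / m * ∑ j ∈ Finset.range m, ‖S ^ j *ᵥ u‖ := by
  obtain ⟨c, N, hc, h⟩ := norm_pow_apply_le_mean (Matrix.toLinAlgEquiv' S) _ hS
  refine ⟨c, N, hc, fun m hm u => ?_⟩
  have hp : ∀ j, (Matrix.toLinAlgEquiv' S ^ j) u = S ^ j *ᵥ u := by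
    intro j
    rw [← map_pow, Matrix.toLinAlgEquiv'_apply]
  simp only [← hp]
  refine h m hm u ?_
  rw [← (IsAlgClosed.splits S.charpoly).eq_prod_roots_of_monic S.charpoly_monic,
    Polynomial.aeval_algHom_apply, aeval_self_charpoly, map_zero, LinearMap.zero_apply]

/-! ### The rate O(1/m) of the deviation, over ℂ. -/

theorem norm_le_one_of_gap_tendsto {D T : Mat ℂ n} (hD : D.PosDef)
    (h : Tendsto (gap D T) atTop (𝓝 0)) : ∀ z ∈ Tᴴ.charpoly.roots, ‖z‖ ≤ 1 := by
  intro z hz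
  have hz0 : (scalar (Fin n) z - Tᴴ).det = 0 := by
    rw [← eval_charpoly]
    exact (Polynomial.mem_roots'.1 hz).2
  obtain ⟨u, hu0, hu⟩ := exists_mulVec_eq_zero_iff.2 hz0
  have hTu : Tᴴ *ᵥ u = z • u := by
    rw [sub_mulVec, sub_eq_zero] at hu
    rw [← hu]
    ext i
    simp [scalar_apply, mulVec_diagonal]
  have hTj : ∀ j, Tᴴ ^ j *ᵥ u = z ^ j • u := by
    intro j
    induction j with
    | zero => simp
    | succ j ih => rw [pow_succ', ← mulVec_mulVec, ih, mulVec_smul, hTu, smul_smul, pow_succ]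
  by_contra! hz1
  set x := ‖z‖ ^ 2 with hx
  have hx1 : 1 < x := one_lt_pow₀ hz1 two_ne_zero
  set κ := quad D⁻¹ u with hκ
  have hκ0 : 0 ≤ κ := quad_nonneg (nonneg_of_posDef hD.inv) u
  have hc : 0 < ‖star u ⬝ᵥ u‖ ^ 2 := by
    have : star u ⬝ᵥ u ≠ 0 := fun h => hu0 (dotProduct_star_self_eq_zero.1 h)
    positivity
  -- On an eigenvector of Tᴴ the Gram sum is κ times a geometric sum, at most κ xᵐ/(x - 1).
  -- Cauchy–Schwarz between u and Tᵐ u then bounds `gap` away from 0.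
  have hbound : ∀ m ≥ 1, (x - 1) * ‖star u ⬝ᵥ u‖ ^ 2 ≤ κ * quad (gap D T m) u := by
    intro m hm
    have h1 := norm_dotProduct_sq_le_quad (gram_posDef hD T hm) u (T ^ m *ᵥ u)
    have h2 : star u ⬝ᵥ T ^ m *ᵥ u = star (z ^ m) * (star u ⬝ᵥ u) := by
      rw [dotProduct_mulVec, ← smul_eq_mul, ← smul_dotProduct, ← star_smul, ← hTj, star_mulVec,
        ← conjTranspose_pow, conjTranspose_conjTranspose]
    have h3 : quad (gram D T m) u = (∑ j ∈ Finset.range m, x ^ j) * κ := by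
      rw [quad_gram, Finset.sum_mul]
      refine Finset.sum_congr rfl fun j _ => ?_
      rw [hTj, quad_smul_right, norm_pow, hx]
      ring
    rw [h2, ← quad_conj, norm_mul, norm_star, norm_pow, mul_pow, h3,
      show (‖z‖ ^ m) ^ 2 = x ^ m by rw [hx]; ring] at h1
    have hq : 0 ≤ quad (gap D T m) u := quad_nonneg (gap_nonneg hD T hm) u
    have h4 : (∑ j ∈ Finset.range m, x ^ j) * (x - 1) ≤ x ^ m := by
      rw [geom_sum_mul]; linarith
    have hxm : 0 < x ^ m := by positivity
    have h5 : x ^ m * ((x - 1) * ‖star u ⬝ᵥ u‖ ^ 2) ≤ x ^ m * (κ * quad (gap D T m) u) := by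
      calc x ^ m * ((x - 1) * ‖star u ⬝ᵥ u‖ ^ 2)
          = (x - 1) * (x ^ m * ‖star u ⬝ᵥ u‖ ^ 2) := by ring
        _ ≤ (x - 1) * ((∑ j ∈ Finset.range m, x ^ j) * κ * quad (gap D T m) u) :=
            mul_le_mul_of_nonneg_left h1 (by linarith)
        _ = ((∑ j ∈ Finset.range m, x ^ j) * (x - 1)) * (κ * quad (gap D T m) u) := by ring
        _ ≤ _ := mul_le_mul_of_nonneg_right h4 (by positivity)
    exact le_of_mul_le_mul_left h5 hxm
  have hcont : Continuous fun M : Mat ℂ n => κ * quad M u := by unfold quad; fun_prop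
  have hlim := (hcont.tendsto 0).comp h
  have := ge_of_tendsto hlim (eventually_atTop.2 ⟨1, fun m hm => hbound m hm⟩)
  have h0 : quad (0 : Mat ℂ n) u = 0 := by simp [quad]
  rw [h0, mul_zero] at this
  nlinarith

/-- Cauchy–Schwarz against the basis vectors bounds each |uᵢ|² by the trace of M⁻¹ times the form of
M at u. -/
theorem exists_norm_sq_le_quad {M : Mat 𝕜 n} (hM : M.PosDef) :
    ∃ c : ℝ, 0 < c ∧ ∀ u, ‖u‖ ^ 2 ≤ c * quad M u := by
  refine ⟨RCLike.re M⁻¹.trace + 1, ?_, fun u => ?_⟩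
  · have := (RCLike.nonneg_iff.1 hM.inv.posSemidef.trace_nonneg).1
    linarith
  · have hq := quad_nonneg (nonneg_of_posDef hM) u
    have htr := (RCLike.nonneg_iff.1 hM.inv.posSemidef.trace_nonneg).1
    have hr : 0 ≤ (RCLike.re M⁻¹.trace + 1) * quad M u := by positivity
    have : ‖u‖ ≤ √((RCLike.re M⁻¹.trace + 1) * quad M u) := by
      refine (pi_norm_le_iff_of_nonneg (Real.sqrt_nonneg _)).2 fun i => Real.le_sqrt_of_sq_le ?_
      have h1 := norm_dotProduct_sq_le_quad hM u (Pi.single i 1)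
      rw [dotProduct_single_one, Pi.star_apply, norm_star, quad.eq_def M⁻¹] at h1
      have h2 : RCLike.re (star (Pi.single i 1) ⬝ᵥ M⁻¹ *ᵥ Pi.single i 1) ≤
          RCLike.re M⁻¹.trace := by
        have h3 := norm_entry_le_trace (nonneg_of_posDef hM.inv) i i
        rw [← Pi.single_star, star_one, single_one_dotProduct, mulVec_single_one, col_apply]
        exact (RCLike.re_le_norm _).trans h3
      nlinarith
    calc ‖u‖ ^ 2 ≤ √((RCLike.re M⁻¹.trace + 1) * quad M u) ^ 2 := by gcongr
      _ = _ := Real.sq_sqrt hr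

theorem norm_dotProduct_le (u v : Fin n → ℂ) : ‖u ⬝ᵥ v‖ ≤ n * (‖u‖ * ‖v‖) := by
  refine (norm_sum_le _ _).trans ?_
  calc ∑ i, ‖u i * v i‖ ≤ ∑ _i : Fin n, ‖u‖ * ‖v‖ := Finset.sum_le_sum fun i _ => by
        rw [norm_mul]
        exact mul_le_mul (norm_le_pi_norm u i) (norm_le_pi_norm v i) (norm_nonneg _) (norm_nonneg _)
    _ = _ := by simp

theorem quad_gap_le_of_norm_le_one {D T : Mat ℂ n} (hD : D.PosDef)
    (hT : ∀ z ∈ Tᴴ.charpoly.roots, ‖z‖ ≤ 1) :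
    ∃ (c : ℝ) (N : ℕ), 1 ≤ N ∧ 0 ≤ c ∧ ∀ m ≥ N, ∀ v, quad (gap D T m) v ≤ c / m * ‖v‖ ^ 2 := by
  obtain ⟨c, N, hc, h⟩ := norm_pow_mulVec_le_mean Tᴴ hT
  obtain ⟨e, he, hDe⟩ := exists_norm_sq_le_quad hD.inv
  refine ⟨n ^ 2 * (c ^ 2 * e), N + 1, Nat.le_add_left 1 N, by positivity, fun m hm v => ?_⟩
  have hm1 : 1 ≤ m := by omega
  have hm0 : (0 : ℝ) < m := by positivity
  have hK := gram_posDef hD T hm1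
  -- This u has q equal both to the form of K_m at u and to the pairing of (Tᴴ)ᵐ u with v. The mean
  -- estimate bounds ‖(Tᴴ)ᵐ u‖² by a multiple of q/m, so q² is at most a multiple of (q/m) ‖v‖², and
  -- one q cancels.
  set u := (gram D T m)⁻¹ *ᵥ (T ^ m *ᵥ v) with hu
  have hqu : quad (gram D T m) u = quad (gap D T m) v := by
    rw [hu, ← quad_conj, hK.inv.isHermitian.eq, inv_mul_of_isUnit hK.isUnit, Matrix.one_mul,
      ← quad_conj, gap]
  have hq : quad (gap D T m) v = RCLike.re (star (Tᴴ ^ m *ᵥ u) ⬝ᵥ v) := by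
    rw [← conjTranspose_pow, star_mulVec, conjTranspose_conjTranspose, ← dotProduct_mulVec, hu,
      star_mulVec, hK.inv.isHermitian.eq, ← dotProduct_mulVec, gap, ← quad.eq_def, quad_conj]
  set q := quad (gap D T m) v with hqd
  have hq0 : 0 ≤ q := quad_nonneg (gap_nonneg hD T hm1) v
  have h1 : q ≤ n * (‖Tᴴ ^ m *ᵥ u‖ * ‖v‖) := by
    rw [hq, ← norm_star (Tᴴ ^ m *ᵥ u)]
    exact (RCLike.re_le_norm _).trans (norm_dotProduct_le _ _)
  have h2 : ‖Tᴴ ^ m *ᵥ u‖ ^ 2 ≤ c ^ 2 * e / m * q := by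
    have h3 := h m (by omega) u
    have h4 : (∑ j ∈ Finset.range m, ‖Tᴴ ^ j *ᵥ u‖) ^ 2 ≤
        m * ∑ j ∈ Finset.range m, ‖Tᴴ ^ j *ᵥ u‖ ^ 2 := by
      simpa using sq_sum_le_card_mul_sum_sq (s := Finset.range m) (f := fun j => ‖Tᴴ ^ j *ᵥ u‖)
    have h5 : ∑ j ∈ Finset.range m, ‖Tᴴ ^ j *ᵥ u‖ ^ 2 ≤ e * q := by
      rw [← hqu, quad_gram, Finset.mul_sum]
      exact Finset.sum_le_sum fun j _ => hDe _
    calc ‖Tᴴ ^ m *ᵥ u‖ ^ 2 ≤ (c / m * ∑ j ∈ Finset.range m, ‖Tᴴ ^ j *ᵥ u‖) ^ 2 := by gcongr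
      _ = (c / m) ^ 2 * (∑ j ∈ Finset.range m, ‖Tᴴ ^ j *ᵥ u‖) ^ 2 := by ring
      _ ≤ (c / m) ^ 2 * (m * (e * q)) := by gcongr; exact h4.trans (by gcongr)
      _ = c ^ 2 * e / m * q := by field_simp
  have h6 : q ^ 2 ≤ (n ^ 2 * (c ^ 2 * e) / m * ‖v‖ ^ 2) * q := by
    calc q ^ 2 ≤ (n * (‖Tᴴ ^ m *ᵥ u‖ * ‖v‖)) ^ 2 := by gcongr
      _ = n ^ 2 * ‖v‖ ^ 2 * ‖Tᴴ ^ m *ᵥ u‖ ^ 2 := by ring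
      _ ≤ n ^ 2 * ‖v‖ ^ 2 * (c ^ 2 * e / m * q) := by gcongr
      _ = _ := by ring
  rcases hq0.eq_or_lt with h0 | h0
  · rw [← h0]; positivity
  · rw [sq] at h6
    exact le_of_mul_le_mul_right h6 h0

/-! ### Complexification and the rate over 𝕜. -/

/-- The canonical embedding of `𝕜` into `ℂ` as a ring homomorphism. -/
noncomputable def toComplex (𝕜 : Type*) [RCLike 𝕜] : 𝕜 →+* ℂ where
  toFun x := ⟨RCLike.re x, RCLike.im x⟩
  map_one' := by apply Complex.ext <;> simp
  map_zero' := by apply Complex.ext <;> simp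
  map_add' x y := by apply Complex.ext <;> simp
  map_mul' x y := by apply Complex.ext <;> simp

theorem toComplex_star (x : 𝕜) : toComplex 𝕜 (star x) = star (toComplex 𝕜 x) := by
  apply Complex.ext <;> simp [toComplex]

theorem continuous_toComplex : Continuous (toComplex 𝕜) := by
  have : (fun x : 𝕜 => (RCLike.re x : ℂ) + (RCLike.im x : ℂ) * Complex.I) = toComplex 𝕜 := by
    funext x
    apply Complex.ext <;> simp [toComplex]
  rw [← this]
  exact (Complex.continuous_ofReal.comp RCLike.continuous_re).add
    ((Complex.continuous_ofReal.comp RCLike.continuous_im).mul continuous_const)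

/-- The complexification of matrices. -/
noncomputable def matToComplex (𝕜 : Type*) [RCLike 𝕜] (n : ℕ) : Mat 𝕜 n →+* Mat ℂ n :=
  (toComplex 𝕜).mapMatrix

theorem matToComplex_conjTranspose (M : Mat 𝕜 n) :
    matToComplex 𝕜 n Mᴴ = (matToComplex 𝕜 n M)ᴴ := by
  ext i j
  exact toComplex_star (M j i)

theorem matToComplex_inv {M : Mat 𝕜 n} (h : IsUnit M) :
    matToComplex 𝕜 n M⁻¹ = (matToComplex 𝕜 n M)⁻¹ :=
  (inv_eq_right_inv (by rw [← map_mul, mul_inv_of_isUnit h, map_one])).symm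

theorem matToComplex_posDef {M : Mat 𝕜 n} (h : M.PosDef) : (matToComplex 𝕜 n M).PosDef := by
  refine posDef_of_nonneg ?_ (h.isUnit.map _)
  obtain ⟨G, rfl⟩ := exists_conjTranspose_mul_self (nonneg_of_posDef h)
  rw [map_mul, matToComplex_conjTranspose]
  exact (posSemidef_conjTranspose_mul_self _).nonneg

theorem matToComplex_gap {D : Mat 𝕜 n} (hD : D.PosDef) (T : Mat 𝕜 n) {m : ℕ} (hm : 1 ≤ m) :
    matToComplex 𝕜 n (gap D T m) = gap (matToComplex 𝕜 n D) (matToComplex 𝕜 n T) m := by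
  have hg : matToComplex 𝕜 n (gram D T m) = gram (matToComplex 𝕜 n D) (matToComplex 𝕜 n T) m := by
    simp only [gram, map_sum, map_mul, map_pow, matToComplex_conjTranspose,
      matToComplex_inv hD.isUnit]
  rw [gap, map_mul, map_mul, map_pow, matToComplex_conjTranspose, map_pow,
    matToComplex_inv (gram_posDef hD T hm).isUnit, hg, gap]

theorem trace_gap_le {D T : Mat 𝕜 n} (hD : D.PosDef) (h : Tendsto (gap D T) atTop (𝓝 0)) :
    ∃ c : ℝ, 0 ≤ c ∧ ∀ m ≥ 1, RCLike.re (gap D T m).trace ≤ c / m := by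
  set D' := matToComplex 𝕜 n D
  set T' := matToComplex 𝕜 n T
  have hD' : D'.PosDef := matToComplex_posDef hD
  have hcont : Continuous (matToComplex 𝕜 n) :=
    continuous_id.matrix_map continuous_toComplex
  have h' : Tendsto (gap D' T') atTop (𝓝 0) := by
    have h1 := (hcont.tendsto 0).comp h
    rw [map_zero] at h1
    refine h1.congr' (eventually_atTop.2 ⟨1, fun m hm => matToComplex_gap hD T hm⟩)
  obtain ⟨c, N, hN, hc, hb⟩ := quad_gap_le_of_norm_le_one hD' (norm_le_one_of_gap_tendsto hD' h')
  have htr : ∀ m ≥ 1, 0 ≤ RCLike.re (gap D T m).trace := fun m hm =>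
    (RCLike.nonneg_iff.1 (gap_nonneg hD T hm).posSemidef.trace_nonneg).1
  have hlarge : ∀ m ≥ N, RCLike.re (gap D T m).trace ≤ n * c / m := by
    intro m hm
    have h1 : RCLike.re (gap D T m).trace = ∑ i, quad (gap D' T' m) (Pi.single i 1) := by
      rw [trace, map_sum]
      refine Finset.sum_congr rfl fun i _ => ?_
      rw [← matToComplex_gap hD T (hN.trans hm), quad, ← Pi.single_star, star_one,
        single_one_dotProduct, mulVec_single_one, col_apply]
      rfl
    rw [h1]
    calc ∑ i, quad (gap D' T' m) (Pi.single i 1) ≤ ∑ _i : Fin n, c / m :=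
          Finset.sum_le_sum fun i _ => by
            simpa [Pi.norm_single] using hb m hm (Pi.single i 1)
      _ = n * c / m := by simp; ring
  have hsum : 0 ≤ ∑ j ∈ Finset.range N, j * RCLike.re (gap D T j).trace := by
    refine Finset.sum_nonneg fun j _ => ?_
    rcases Nat.eq_zero_or_pos j with rfl | hj
    · simp
    · exact mul_nonneg (Nat.cast_nonneg _) (htr j hj)
  -- The sum absorbs the finitely many m < N not covered by the asymptotic bound.
  refine ⟨n * c + ∑ j ∈ Finset.range N, j * RCLike.re (gap D T j).trace, by positivity,
    fun m hm => ?_⟩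
  have hm0 : (0 : ℝ) < m := by positivity
  rcases le_or_gt N m with hNm | hNm
  · exact (hlarge m hNm).trans (by gcongr; linarith)
  · rw [le_div_iff₀ hm0, mul_comm]
    have := Finset.single_le_sum (f := fun j : ℕ => (j : ℝ) * RCLike.re (gap D T j).trace)
      (fun j _ => by
        rcases Nat.eq_zero_or_pos j with rfl | hj
        · simp
        · exact mul_nonneg (Nat.cast_nonneg _) (htr j hj)) (Finset.mem_range.2 hNm)
    have hnc : 0 ≤ n * c := by positivity
    linarith

/-! ### Closed form of the accelerated iteration. -/

/-- The closed form of the `m`-fold iterate, in terms of a solution `X`, of `D = X - B⁽¹⁾` and of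
the closed-loop matrix `T`. -/
noncomputable def iterTriple (X D T : Mat 𝕜 n) (m : ℕ) : Triple 𝕜 n where
  A := (gram D T m)⁻¹ * T ^ m
  B := X - (gram D T m)⁻¹
  Q := X + gap D T m

theorem iterTriple_pivot_posDef (X : Mat 𝕜 n) {D : Mat 𝕜 n} (hD : D.PosDef) (T : Mat 𝕜 n)
    {a b : ℕ} (ha : 1 ≤ a) (hb : 1 ≤ b) :
    ((iterTriple X D T a).Q - (iterTriple X D T b).B).PosDef := by
  have : (iterTriple X D T a).Q - (iterTriple X D T b).B = (gram D T b)⁻¹ + gap D T a := by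
    simp only [iterTriple]; abel
  rw [this]
  exact posDef_of_le (gram_posDef hD T hb).inv (le_add_of_nonneg_right (gap_nonneg hD T ha))

/-- The pivot is G = K_b⁻¹ + gap_a, exactly the matrix inverted when Woodbury is applied to K_{a+b}
= K_a + Tᵃ K_b (Tᵃ)ᴴ. So the step performs this addition on inverses. -/
theorem step_iterTriple (X : Mat 𝕜 n) {D : Mat 𝕜 n} (hD : D.PosDef) (T : Mat 𝕜 n)
    {a b : ℕ} (ha : 1 ≤ a) (hb : 1 ≤ b) :
    step (iterTriple X D T a) (iterTriple X D T b) = iterTriple X D T (a + b) := by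
  have hGp := iterTriple_pivot_posDef X hD T ha hb
  have hGd : (iterTriple X D T a).Q - (iterTriple X D T b).B = (gram D T b)⁻¹ + gap D T a := by
    simp only [iterTriple]; abel
  have hKa := gram_posDef hD T ha
  have hKb := gram_posDef hD T hb
  have hPa : (gram D T a)⁻¹ᴴ = (gram D T a)⁻¹ := hKa.inv.isHermitian.eq
  have hPb : (gram D T b)⁻¹ᴴ = (gram D T b)⁻¹ := hKb.inv.isHermitian.eq
  rw [hGd] at hGp
  have hinv : (gram D T (a + b))⁻¹ = (gram D T a)⁻¹ - (gram D T a)⁻¹ * T ^ a *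
      ((gram D T b)⁻¹ + gap D T a)⁻¹ * (T ^ a)ᴴ * (gram D T a)⁻¹ := by
    have h := schur_inv (X := gram D T a) (N := (gram D T b)⁻¹) (U := -T ^ a) (V := (T ^ a)ᴴ)
      hKa.isUnit hKb.inv.isUnit (by
        rw [mul_neg, sub_neg_eq_add]; exact hGp.isUnit)
    rw [inv_inv_of_isUnit hKb.isUnit] at h
    simp only [neg_mul, sub_neg_eq_add, mul_neg] at h
    rw [gram_add, h, ← gap, ← sub_eq_add_neg]
  set G := (gram D T b)⁻¹ + gap D T a with hG
  have hgap : (T ^ a)ᴴ * (gram D T a)⁻¹ * T ^ a = G - (gram D T b)⁻¹ := by rw [hG, gap]; abel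
  have hA : (gram D T (a + b))⁻¹ * T ^ a = (gram D T a)⁻¹ * T ^ a * G⁻¹ * (gram D T b)⁻¹ := by
    calc (gram D T (a + b))⁻¹ * T ^ a
        = (gram D T a)⁻¹ * T ^ a - (gram D T a)⁻¹ * T ^ a * G⁻¹ *
            ((T ^ a)ᴴ * (gram D T a)⁻¹ * T ^ a) := by rw [hinv]; noncomm_ring
      _ = (gram D T a)⁻¹ * T ^ a - (gram D T a)⁻¹ * T ^ a * (G⁻¹ * G) +
            (gram D T a)⁻¹ * T ^ a * G⁻¹ * (gram D T b)⁻¹ := by rw [hgap]; noncomm_ring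
      _ = _ := by rw [inv_mul_of_isUnit hGp.isUnit]; noncomm_ring
  have hQ : (T ^ a)ᴴ * ((gram D T (a + b))⁻¹ * T ^ a) =
      (gram D T b)⁻¹ - (gram D T b)⁻¹ * G⁻¹ * (gram D T b)⁻¹ := by
    calc (T ^ a)ᴴ * ((gram D T (a + b))⁻¹ * T ^ a)
        = ((T ^ a)ᴴ * (gram D T a)⁻¹ * T ^ a) * G⁻¹ * (gram D T b)⁻¹ := by rw [hA]; noncomm_ring
      _ = (G * G⁻¹) * (gram D T b)⁻¹ - (gram D T b)⁻¹ * G⁻¹ * (gram D T b)⁻¹ := by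
          rw [hgap]; noncomm_ring
      _ = _ := by rw [mul_inv_of_isUnit hGp.isUnit, Matrix.one_mul]
  apply Triple.ext
  · simp only [step]
    rw [hGd]
    simp only [iterTriple]
    rw [pow_add, ← Matrix.mul_assoc (gram D T (a + b))⁻¹, hA]
    simp only [Matrix.mul_assoc]
  · simp only [step]
    rw [hGd]
    simp only [iterTriple]
    rw [hinv, conjTranspose_mul, hPa]
    noncomm_ring
  · simp only [step]
    rw [hGd]
    simp only [iterTriple]
    have h1 : gap D T (a + b) =
        (T ^ b)ᴴ * ((T ^ a)ᴴ * ((gram D T (a + b))⁻¹ * T ^ a)) * T ^ b := by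
      rw [gap, pow_add, conjTranspose_mul]
      simp only [Matrix.mul_assoc]
    rw [h1, hQ, gap, conjTranspose_mul, hPb]
    noncomm_ring

/-- The triple of the dual equation that corresponds to `E`. -/
def dualTriple (Q : Mat 𝕜 n) (E : Triple 𝕜 n) : Triple 𝕜 n where
  A := E.Aᴴ
  B := Q - E.Q
  Q := Q - E.B

/-- Duality exchanges B and Q and reverses the factors. The reversal is harmless because in closed
form only the sum of the indices counts. -/
theorem step_dualTriple (Q : Mat 𝕜 n) {C Y : Triple 𝕜 n} (h : (C.Q - Y.B).IsHermitian) :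
    step (dualTriple Q Y) (dualTriple Q C) = dualTriple Q (step C Y) := by
  have e : (Q - Y.B) - (Q - C.Q) = C.Q - Y.B := by abel
  have hi : (C.Q - Y.B)⁻¹ᴴ = (C.Q - Y.B)⁻¹ := h.inv.eq
  simp only [step, dualTriple, e, conjTranspose_mul, hi, conjTranspose_conjTranspose, Triple.mk.injEq]
  refine ⟨by rw [Matrix.mul_assoc], by abel, by abel⟩

/-- `E` is the `m`-fold iterate, and its dual the `m`-fold dual iterate. -/
structure IsIter (Q X D T Y D' T' : Mat 𝕜 n) (m : ℕ) (E : Triple 𝕜 n) : Prop where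
  primal : E = iterTriple X D T m
  dual : dualTriple Q E = iterTriple Y D' T' m

theorem IsIter.step {Q X D T Y D' T' : Mat 𝕜 n} (hD : D.PosDef) (hD' : D'.PosDef) {a b : ℕ}
    (ha : 1 ≤ a) (hb : 1 ≤ b) {C E : Triple 𝕜 n} (hC : IsIter Q X D T Y D' T' a C)
    (hE : IsIter Q X D T Y D' T' b E) : IsIter Q X D T Y D' T' (a + b) (MatrixEq.step C E) where
  primal := by rw [hC.primal, hE.primal, step_iterTriple X hD T ha hb]
  dual := by
    rw [← step_dualTriple, hC.dual, hE.dual, step_iterTriple Y hD' T' hb ha, add_comm]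
    rw [hC.primal, hE.primal]
    exact (iterTriple_pivot_posDef X hD T ha hb).isHermitian

theorem IsIter.inner {Q X D T Y D' T' : Mat 𝕜 n} (hD : D.PosDef) (hD' : D'.PosDef) {a : ℕ}
    (ha : 1 ≤ a) {C : Triple 𝕜 n} (hC : IsIter Q X D T Y D' T' a C) (i : ℕ) :
    IsIter Q X D T Y D' T' ((i + 1) * a) (MatrixEq.inner C i) := by
  induction i with
  | zero => simpa [MatrixEq.inner] using hC
  | succ i ih =>
    rw [show (i + 1 + 1) * a = a + (i + 1) * a by ring]
    exact hC.step hD hD' ha (by nlinarith) ih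

theorem isIter_accel {s : ℤˣ} {f : Mat 𝕜 n → Mat 𝕜 n} {A Q : Mat 𝕜 n} {r : ℕ} (hr : 2 ≤ r)
    {X D T Y D' T' : Mat 𝕜 n} (hD : D.PosDef) (hD' : D'.PosDef)
    (h : IsIter Q X D T Y D' T' 1 (initial s f A Q)) (k : ℕ) :
    IsIter Q X D T Y D' T' (r ^ k) (accel s f A Q r k) := by
  induction k with
  | zero => simpa [accel] using h
  | succ k ih =>
    have hk : 1 ≤ r ^ k := Nat.one_le_pow _ _ (by omega)
    have h1 := ih.step hD hD' hk (by nlinarith) (ih.inner hD hD' hk (r - 2))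
    -- The inner value at r - 2 has index (r - 1) rᵏ; truncated subtraction makes r ≥ 2 necessary.
    have h2 : r ^ k + (r - 2 + 1) * r ^ k = r ^ (k + 1) := by
      obtain ⟨q, rfl⟩ : ∃ q, r = q + 2 := ⟨r - 2, by omega⟩
      rw [Nat.add_sub_cancel, pow_succ]
      ring
    rwa [h2] at h1

theorem isIter_one {E : Triple 𝕜 n} {Q X Y : Mat 𝕜 n} (hX : IsStdMax E.A (E.Q - E.B) (X - E.B))
    (hY : IsStdMax E.Aᴴ (E.Q - E.B) (Y - (Q - E.Q))) :
    IsIter Q X (X - E.B) ((X - E.B)⁻¹ * E.A) Y (Y - (Q - E.Q)) ((Y - (Q - E.Q))⁻¹ * E.Aᴴ) 1 E := by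
  have key : ∀ {D A : Mat 𝕜 n}, D.PosDef → D * (D⁻¹ * A) = A ∧
      gap D (D⁻¹ * A) 1 = Aᴴ * D⁻¹ * A := by
    intro D A hD
    have h1 : D * (D⁻¹ * A) = A := by
      rw [← Matrix.mul_assoc, mul_inv_of_isUnit hD.isUnit, Matrix.one_mul]
    refine ⟨h1, ?_⟩
    rw [gap, gram_one, pow_one, inv_inv_of_isUnit hD.isUnit, Matrix.mul_assoc, h1,
      conjTranspose_mul, hD.inv.isHermitian.eq]
  have eX := eq_add_of_eq_stdMap hX.eq
  have eY := eq_add_of_eq_stdMap hY.eq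
  constructor
  · apply Triple.ext
    · simp only [iterTriple, gram_one, pow_one, inv_inv_of_isUnit hX.posDef.isUnit,
        (key hX.posDef).1]
    · simp only [iterTriple, gram_one, inv_inv_of_isUnit hX.posDef.isUnit]
      abel
    · simp only [iterTriple, (key hX.posDef).2]
      have := eq_sub_of_add_eq' eX.symm
      rw [this]
      abel
  · apply Triple.ext
    · simp only [dualTriple, iterTriple, gram_one, pow_one, inv_inv_of_isUnit hY.posDef.isUnit,
        (key hY.posDef).1]
    · simp only [dualTriple, iterTriple, gram_one, inv_inv_of_isUnit hY.posDef.isUnit]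
      abel
    · simp only [dualTriple, iterTriple, (key hY.posDef).2]
      have := eq_sub_of_add_eq' eY.symm
      rw [this]
      abel

/-! ### Norm estimates and convergence. -/

section Norm

open scoped Matrix.Norms.L2Operator

theorem exists_norm_le_trace (𝕜 : Type*) [RCLike 𝕜] (n : ℕ) :
    ∃ c : ℝ, 0 ≤ c ∧ ∀ M : Mat 𝕜 n, 0 ≤ M → ‖M‖ ≤ c * RCLike.re M.trace := by
  refine ⟨∑ i, ∑ j, ‖(single i j 1 : Mat 𝕜 n)‖, by positivity, fun M hM => ?_⟩
  calc ‖M‖ = ‖∑ i, ∑ j, M i j • (single i j 1 : Mat 𝕜 n)‖ := by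
        conv_lhs => rw [matrix_eq_sum_single M]
        simp [smul_single]
    _ ≤ ∑ i, ∑ j, ‖M i j • (single i j 1 : Mat 𝕜 n)‖ :=
        (norm_sum_le _ _).trans (Finset.sum_le_sum fun i _ => norm_sum_le _ _)
    _ ≤ ∑ i, ∑ j, ‖(single i j 1 : Mat 𝕜 n)‖ * RCLike.re M.trace := by
        refine Finset.sum_le_sum fun i _ => Finset.sum_le_sum fun j _ => ?_
        rw [norm_smul, mul_comm]
        exact mul_le_mul_of_nonneg_left (norm_entry_le_trace hM i j) (norm_nonneg _)
    _ = _ := by simp only [Finset.sum_mul]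

/-- Write W = Gᴴ G and use submultiplicativity with the C*-identity. It controls A, which is not
semidefinite, by semidefinite increments. -/
theorem norm_mul_mul_sq_le {W : Mat 𝕜 n} (hW : 0 ≤ W) (A B : Mat 𝕜 n) :
    ‖A * W * B‖ ^ 2 ≤ ‖A * W * Aᴴ‖ * ‖Bᴴ * W * B‖ := by
  obtain ⟨G, rfl⟩ := exists_conjTranspose_mul_self hW
  have h1 : ‖A * (Gᴴ * G) * B‖ ≤ ‖A * Gᴴ‖ * ‖G * B‖ := by
    rw [show A * (Gᴴ * G) * B = (A * Gᴴ) * (G * B) by noncomm_ring]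
    exact norm_mul_le _ _
  have h2 : ‖A * (Gᴴ * G) * Aᴴ‖ = ‖A * Gᴴ‖ ^ 2 := by
    rw [sq, ← CStarRing.norm_self_mul_star, star_eq_conjTranspose, conjTranspose_mul,
      conjTranspose_conjTranspose]
    noncomm_ring
  have h3 : ‖Bᴴ * (Gᴴ * G) * B‖ = ‖G * B‖ ^ 2 := by
    rw [sq, ← CStarRing.norm_star_mul_self, star_eq_conjTranspose, conjTranspose_mul]
    noncomm_ring
  rw [h2, h3, ← mul_pow]
  gcongr

theorem convergesRLinearly_of_norm_le {Z : ℕ → Mat 𝕜 n} {L : Mat 𝕜 n} {r : ℕ} (hr : 2 ≤ r) {c : ℝ}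
    (h : ∀ k ≥ 1, ‖Z k - L‖ ≤ c / r ^ k) : ConvergesRLinearly Z L (1 / r) := by
  have hr' : (2 : ℝ) ≤ r := by exact_mod_cast hr
  have hr0 : (0 : ℝ) < r := by linarith
  refine ⟨by positivity, by rw [div_lt_one hr0]; linarith, |c| + 1, by positivity, fun k hk => ?_⟩
  rw [one_div, inv_pow, ← div_eq_mul_inv]
  refine (h k hk).trans_lt ?_
  have := le_abs_self c
  gcongr
  linarith

/-- Well-definedness and R-linear convergence of the accelerated iteration, given the maximal
solutions of the two standard equations. -/
theorem accel_converges {s : ℤˣ} {f : Mat 𝕜 n → Mat 𝕜 n} {A Q X Y : Mat 𝕜 n} {r : ℕ} (hr : 2 ≤ r)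
    (hX : IsStdMax (initial s f A Q).A ((initial s f A Q).Q - (initial s f A Q).B)
      (X - (initial s f A Q).B))
    (hY : IsStdMax (initial s f A Q).Aᴴ ((initial s f A Q).Q - (initial s f A Q).B)
      (Y - (Q - (initial s f A Q).Q))) :
    (∀ k i, IsUnit ((accel s f A Q r k).Q - (inner (accel s f A Q r k) i).B)) ∧
    ConvergesRLinearly (fun k => (accel s f A Q r k).A) 0 (1 / r) ∧
    ConvergesRLinearly (fun k => (accel s f A Q r k).Q) X (1 / r) ∧
    ConvergesRLinearly (fun k => (accel s f A Q r k).B) (Q - Y) (1 / r) := by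
  have h1 := isIter_one hX hY
  have hg := gap_tendsto_zero hX
  have hg' := gap_tendsto_zero hY
  have hD := hX.posDef
  have hD' := hY.posDef
  generalize X - (initial s f A Q).B = D at h1 hg hD
  generalize Y - (Q - (initial s f A Q).Q) = D' at h1 hg' hD'
  generalize D⁻¹ * (initial s f A Q).A = T at h1 hg
  generalize D'⁻¹ * (initial s f A Q).Aᴴ = T' at h1 hg'
  have hk : ∀ k, 1 ≤ r ^ k := fun k => Nat.one_le_pow _ _ (by omega)
  have hit := isIter_accel hr hD hD' h1
  have hin : ∀ k i, IsIter Q X D T Y D' T' ((i + 1) * r ^ k) (inner (accel s f A Q r k) i) :=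
    fun k i => (hit k).inner hD hD' (hk k) i
  have hpiv : ∀ k i, ((accel s f A Q r k).Q - (inner (accel s f A Q r k) i).B).PosDef := by
    intro k i
    rw [(hin k i).primal, (hit k).primal]
    exact iterTriple_pivot_posDef X hD T (hk k) (by nlinarith [hk k])
  obtain ⟨c, hc, hcb⟩ := trace_gap_le hD hg
  obtain ⟨c', hc', hcb'⟩ := trace_gap_le hD' hg'
  obtain ⟨e, he, heb⟩ := exists_norm_le_trace 𝕜 n
  have hQk : ∀ {m E}, IsIter Q X D T Y D' T' m E → E.Q = X + gap D T m := fun h => by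
    rw [h.primal]; rfl
  have hBk : ∀ {m E}, IsIter Q X D T Y D' T' m E → E.B = Q - Y - gap D' T' m := fun {m E} h => by
    have h2 : Q - E.B = Y + gap D' T' m := congrArg Triple.Q h.dual
    rw [sub_sub, ← h2, sub_sub_cancel]
  have hr0 : (0 : ℝ) < r := by exact_mod_cast (by omega : 0 < r)
  refine ⟨fun k i => (hpiv k i).isUnit,
    convergesRLinearly_of_norm_le (c := e * (c + c') * r) hr fun k hk1 => ?_,
    convergesRLinearly_of_norm_le (c := e * c) hr fun k _ => ?_,
    convergesRLinearly_of_norm_le (c := e * c') hr fun k _ => ?_⟩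
  -- With W the inverse pivot, the new A is C.A W E.A. Here C.A W C.Aᴴ is an increment of B and E.Aᴴ
  -- W E.A a decrement of Q, that is, differences of dual and primal gaps, both O(r⁻ᵏ). The estimate
  -- for index k + 1 comes out in rᵏ, hence the extra factor r in the constant.
  · obtain ⟨k, rfl⟩ : ∃ l, k = l + 1 := ⟨k - 1, by omega⟩
    set C := accel s f A Q r k with hC
    set E := inner C (r - 2) with hE
    set b := (r - 2 + 1) * r ^ k with hb
    have hbk : r ^ k ≤ b := by rw [hb]; nlinarith [hk k]
    have hb1 : 1 ≤ b := (hk k).trans hbk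
    have hW : 0 ≤ (C.Q - E.B)⁻¹ := nonneg_of_posDef (hpiv k (r - 2)).inv
    have hS := (hit k).step hD hD' (hk k) hb1 (hin k (r - 2))
    have hab : 1 ≤ r ^ k + b := by omega
    have hrk : (0 : ℝ) < (r : ℝ) ^ k := by positivity
    have hp : C.A * (C.Q - E.B)⁻¹ * C.Aᴴ ≤ gap D' T' (r ^ k) := by
      have h3 : C.B + C.A * (C.Q - E.B)⁻¹ * C.Aᴴ = Q - Y - gap D' T' (r ^ k + b) := hBk hS
      rw [hBk (hit k)] at h3
      have h4 : C.A * (C.Q - E.B)⁻¹ * C.Aᴴ = gap D' T' (r ^ k) - gap D' T' (r ^ k + b) := by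
        rw [eq_sub_of_add_eq' h3]; abel
      rw [h4]
      exact sub_le_self _ (gap_nonneg hD' T' hab)
    have hq : E.Aᴴ * (C.Q - E.B)⁻¹ * E.A ≤ gap D T b := by
      have h3 : E.Q - E.Aᴴ * (C.Q - E.B)⁻¹ * E.A = X + gap D T (r ^ k + b) := hQk hS
      rw [hQk (hin k (r - 2))] at h3
      have h4 : E.Aᴴ * (C.Q - E.B)⁻¹ * E.A = gap D T b - gap D T (r ^ k + b) := by
        rw [← sub_sub_cancel (X + gap D T b) (E.Aᴴ * (C.Q - E.B)⁻¹ * E.A), h3]; abel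
      rw [h4]
      exact sub_le_self _ (gap_nonneg hD T hab)
    have hpn : ‖C.A * (C.Q - E.B)⁻¹ * C.Aᴴ‖ ≤ e * (c' / r ^ k) := by
      refine (heb _ (conj_nonneg' hW _)).trans (mul_le_mul_of_nonneg_left ?_ he)
      simpa using (trace_re_mono hp).trans (hcb' _ (hk k))
    have hqn : ‖E.Aᴴ * (C.Q - E.B)⁻¹ * E.A‖ ≤ e * (c / r ^ k) := by
      refine (heb _ (conj_nonneg hW _)).trans (mul_le_mul_of_nonneg_left ?_ he)
      refine (trace_re_mono hq).trans ((hcb _ hb1).trans ?_)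
      have : (r : ℝ) ^ k ≤ b := by exact_mod_cast hbk
      gcongr
    have hA : (accel s f A Q r (k + 1)).A = C.A * (C.Q - E.B)⁻¹ * E.A := rfl
    have hfin : ‖C.A * (C.Q - E.B)⁻¹ * E.A‖ ≤ e * (c + c') / r ^ k := by
      refine abs_le_of_sq_le_sq' ?_ (by positivity) |>.2
      calc ‖C.A * (C.Q - E.B)⁻¹ * E.A‖ ^ 2 ≤ (e * (c' / r ^ k)) * (e * (c / r ^ k)) :=
            (norm_mul_mul_sq_le hW _ _).trans
              (mul_le_mul hpn hqn (norm_nonneg _) (by positivity))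
        _ = (e / r ^ k) ^ 2 * (c' * c) := by ring
        _ ≤ (e / r ^ k) ^ 2 * (c + c') ^ 2 := by gcongr; nlinarith
        _ = _ := by ring
    rw [sub_zero, hA, pow_succ, mul_div_mul_right _ _ hr0.ne']
    exact hfin
  · simp only [hQk (hit k), add_sub_cancel_left]
    refine (heb _ (gap_nonneg hD T (hk k))).trans ?_
    rw [mul_div_assoc]
    exact mul_le_mul_of_nonneg_left (by simpa using hcb _ (hk k)) he
  · simp only [hBk (hit k), sub_sub_cancel_left, norm_neg]
    refine (heb _ (gap_nonneg hD' T' (hk k))).trans ?_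
    rw [mul_div_assoc]
    exact mul_le_mul_of_nonneg_left (by simpa using hcb' _ (hk k)) he

end Norm

/-! ### Algebra of the operator f. -/

namespace IsAdmissible

variable {f : Mat 𝕜 n → Mat 𝕜 n} (hf : IsAdmissible f)
include hf

theorem map_zero : f 0 = 0 := by
  have := hf.map_add 0 0
  rwa [add_zero, left_eq_add] at this

theorem map_one : f 1 = 1 := by
  have := hf.map_mul 1 (f 1)
  rwa [Matrix.one_mul, hf.period_two, Matrix.mul_one, eq_comm] at this

theorem map_neg (M : Mat 𝕜 n) : f (-M) = -f M := by
  have := hf.map_add (-M) M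
  rw [neg_add_cancel, hf.map_zero] at this
  exact eq_neg_of_add_eq_zero_left this.symm

theorem map_sub (M N : Mat 𝕜 n) : f (M - N) = f M - f N := by
  rw [sub_eq_add_neg, hf.map_add, hf.map_neg, sub_eq_add_neg]

theorem isUnit_map {M : Mat 𝕜 n} (h : IsUnit M) : IsUnit (f M) :=
  isUnit_of_mul_eq_one (N := f M⁻¹) (by rw [← hf.map_mul, mul_inv_of_isUnit h, hf.map_one])

theorem isUnit_of_map {M : Mat 𝕜 n} (h : IsUnit (f M)) : IsUnit M := by
  simpa [hf.period_two] using hf.isUnit_map h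

theorem map_inv {M : Mat 𝕜 n} (h : IsUnit M) : f M⁻¹ = (f M)⁻¹ :=
  (inv_eq_right_inv (by rw [← hf.map_mul, mul_inv_of_isUnit h, hf.map_one])).symm

theorem nonneg {M : Mat 𝕜 n} (h : 0 ≤ M) : 0 ≤ f M := (hf.map_nonneg M h.posSemidef).nonneg

theorem mono {M N : Mat 𝕜 n} (h : M ≤ N) : f M ≤ f N := by
  have := hf.nonneg (sub_nonneg.2 h)
  rw [hf.map_sub] at this
  exact sub_nonneg.1 this

theorem posDef {M : Mat 𝕜 n} (h : M.PosDef) : (f M).PosDef :=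
  posDef_of_nonneg (hf.nonneg (nonneg_of_posDef h)) (hf.isUnit_map h.isUnit)

theorem posDef_of_map {M : Mat 𝕜 n} (h : (f M).PosDef) : M.PosDef := by
  simpa [hf.period_two] using hf.posDef h

theorem isHermitian {H : Mat 𝕜 n} (hH : H.IsHermitian) : (f H).IsHermitian := by
  have h1 : ∀ M : Mat 𝕜 n, M.IsHermitian → (f (M * M)).IsHermitian := fun M hM =>
    (hf.map_nonneg _ (by
      have := posSemidef_conjTranspose_mul_self M
      rwa [hM.eq] at this)).1
  -- Only positivity is known to be preserved, so 4H is written as a difference of squares of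
  -- Hermitian matrices.
  have h2 : (H + 1) * (H + 1) - (H - 1) * (H - 1) = H + H + (H + H) := by noncomm_ring
  have h3 : f H + f H + (f H + f H) = f ((H + 1) * (H + 1)) - f ((H - 1) * (H - 1)) := by
    rw [← hf.map_sub, h2, hf.map_add, hf.map_add]
  have h4 : (f H + f H + (f H + f H)).IsHermitian := by
    rw [h3]
    exact (h1 _ (hH.add isHermitian_one)).sub (h1 _ (hH.sub isHermitian_one))
  have h5 : f H + f H + (f H + f H) = (4 : 𝕜) • f H := by module
  rw [h5] at h4
  have h6 : (4 : 𝕜) • (f H)ᴴ = (4 : 𝕜) • f H := by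
    have := h4.eq
    rwa [conjTranspose_smul, star_ofNat] at this
  exact smul_right_injective _ (by norm_num : (4 : 𝕜) ≠ 0) h6

theorem map_imaginary_conjTranspose :
    f ((RCLike.I : 𝕜) • (1 : Mat 𝕜 n))ᴴ = (f ((RCLike.I : 𝕜) • (1 : Mat 𝕜 n)))ᴴ := by
  set J : Mat 𝕜 n := (RCLike.I : 𝕜) • (1 : Mat 𝕜 n) with hJ
  rcases isEmpty_or_nonempty (Fin n) with hn | ⟨⟨i⟩⟩
  · exact Subsingleton.elim _ _
  have hJc : Jᴴ = -J := by
    rw [hJ, conjTranspose_smul, conjTranspose_one, RCLike.star_def, RCLike.conj_I, neg_smul]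
  rcases RCLike.I_mul_I (K := 𝕜) with h0 | h1
  · rw [hJ, h0, zero_smul, conjTranspose_zero, hf.map_zero, conjTranspose_zero]
  -- As f is onto and multiplicative, f J is central, hence a scalar c with c² = -1; then |c| = 1
  -- and star c = -c. No linearity of f over 𝕜 is available: f may conjugate scalars.
  obtain ⟨c, hc⟩ := mem_range_scalar_of_commute_single (M := f J) fun i j _ => by
    have h2 : ∀ N, Commute N (f J) := fun N => by
      have : N * f J = f (f N * J) := by rw [hf.map_mul, hf.period_two]
      rw [Commute, SemiconjBy, this, hJ, mul_smul_comm, Matrix.mul_one, ← Matrix.one_mul (f N),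
        ← smul_mul_assoc, hf.map_mul, hf.period_two]
    exact h2 _
  have hcc : c * c = -1 := by
    have h2 : f J * f J = -1 := by
      rw [← hf.map_mul, hJ, smul_mul_assoc, mul_smul_comm, Matrix.mul_one, smul_smul, h1, neg_smul,
        one_smul, hf.map_neg, hf.map_one]
    rw [← hc, ← RingHom.map_mul] at h2
    have h3 := congrFun (congrFun h2 i) i
    simpa using h3
  have hcs : star c = -c := by
    have hn : ‖c‖ = 1 := by
      have h2 : ‖c‖ * ‖c‖ = 1 := by rw [← norm_mul, hcc, norm_neg, norm_one]
      nlinarith [norm_nonneg c]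
    have h2 : star c * c = 1 := by rw [RCLike.star_def, RCLike.conj_mul, hn]; simp
    have hc0 : c ≠ 0 := fun h => by simp [h] at hn
    refine mul_right_cancel₀ hc0 ?_
    rw [h2, neg_mul, hcc, neg_neg]
  rw [hJc, hf.map_neg, ← hc]
  ext a b
  rcases eq_or_ne a b with rfl | hab
  · simpa using hcs.symm
  · simp [hab, hab.symm]

/-- The matrices with this property are closed under sums and products and contain the Hermitian
ones and the imaginary scalar. These generate every x E_ij; off the diagonal, x E_ij = E_ii (x E_ij
+ x̄ E_ji). -/
theorem map_conjTranspose (M : Mat 𝕜 n) : f Mᴴ = (f M)ᴴ := by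
  have hmul : ∀ M N : Mat 𝕜 n, f Mᴴ = (f M)ᴴ → f Nᴴ = (f N)ᴴ → f (M * N)ᴴ = (f (M * N))ᴴ := by
    intro M N hM hN
    rw [conjTranspose_mul, hf.map_mul, hf.map_mul, conjTranspose_mul, hM, hN]
  have hadd : ∀ M N : Mat 𝕜 n, f Mᴴ = (f M)ᴴ → f Nᴴ = (f N)ᴴ → f (M + N)ᴴ = (f (M + N))ᴴ := by
    intro M N hM hN
    rw [conjTranspose_add, hf.map_add, hf.map_add, conjTranspose_add, hM, hN]
  have hherm : ∀ M : Mat 𝕜 n, M.IsHermitian → f Mᴴ = (f M)ᴴ := by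
    intro M hM
    rw [hM.eq, (hf.isHermitian hM).eq]
  induction M using Matrix.induction_on' with
  | h_zero => rw [conjTranspose_zero, hf.map_zero, conjTranspose_zero]
  | h_add M N hM hN => exact hadd M N hM hN
  | h_std_basis i j x =>
    rcases eq_or_ne i j with rfl | hij
    · have h1 : single i i x = single i i ((RCLike.re x : ℝ) : 𝕜) +
          ((RCLike.I : 𝕜) • (1 : Mat 𝕜 n)) * single i i ((RCLike.im x : ℝ) : 𝕜) := by
        rw [smul_mul_assoc, Matrix.one_mul, smul_single, ← single_add, smul_eq_mul, mul_comm,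
          RCLike.re_add_im]
      have h2 : ∀ t : ℝ, (single i i (t : 𝕜) : Mat 𝕜 n).IsHermitian := fun t => by
        rw [IsHermitian, conjTranspose_single, RCLike.star_def, RCLike.conj_ofReal]
      rw [h1]
      exact hadd _ _ (hherm _ (h2 _)) (hmul _ _ hf.map_imaginary_conjTranspose (hherm _ (h2 _)))
    · have h1 : single i j x = single i i (1 : 𝕜) * (single i j x + single j i (star x)) := by
        rw [mul_add, single_mul_single_same, one_mul,
          single_mul_single_of_ne _ _ _ _ hij, add_zero]
      have h2 : (single i i (1 : 𝕜) : Mat 𝕜 n).IsHermitian := by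
        rw [IsHermitian, conjTranspose_single, star_one]
      have h3 : (single i j x + single j i (star x) : Mat 𝕜 n).IsHermitian := by
        rw [IsHermitian, conjTranspose_add, conjTranspose_single, conjTranspose_single, star_star,
          add_comm]
      rw [h1]
      exact hmul _ _ (hherm _ h2) (hherm _ h3)

theorem map_real_smul (hfc : Continuous f) (t : ℝ) (M : Mat 𝕜 n) : f (t • M) = t • f M :=
  _root_.map_real_smul (AddMonoidHom.mk' f hf.map_add) hfc t M

end IsAdmissible

/-! ### Real scaling and two-cycles of the minus equation. -/

theorem quad_real_smul (t : ℝ) (M : Mat 𝕜 n) (v : Fin n → 𝕜) : quad (t • M) v = t * quad M v := by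
  rw [quad, smul_mulVec, dotProduct_smul, RCLike.smul_re, quad]

theorem real_smul_nonneg {t : ℝ} (ht : 0 ≤ t) {M : Mat 𝕜 n} (hM : 0 ≤ M) : 0 ≤ t • M := by
  refine nonneg_of_quad ?_ fun v => ?_
  · rw [IsHermitian, conjTranspose_smul, star_trivial, (isHermitian_of_nonneg hM).eq]
  · rw [quad_real_smul]
    exact mul_nonneg ht (quad_nonneg hM v)

theorem real_smul_mono {t : ℝ} (ht : 0 ≤ t) {M N : Mat 𝕜 n} (h : M ≤ N) : t • M ≤ t • N := by
  have := real_smul_nonneg ht (sub_nonneg.2 h)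
  rw [smul_sub] at this
  exact sub_nonneg.1 this

theorem quad_le_norm_sq (M : Mat 𝕜 n) (v : Fin n → 𝕜) :
    quad M v ≤ (∑ i, ∑ j, ‖M i j‖) * ‖v‖ ^ 2 := by
  refine (RCLike.re_le_norm _).trans ?_
  rw [dotProduct, Finset.sum_mul]
  refine (norm_sum_le _ _).trans (Finset.sum_le_sum fun i _ => ?_)
  rw [norm_mul, Pi.star_apply, norm_star]
  calc ‖v i‖ * ‖(M *ᵥ v) i‖ ≤ ‖v‖ * ((∑ j, ‖M i j‖) * ‖v‖) := by
        refine mul_le_mul (norm_le_pi_norm v i) ?_ (norm_nonneg _) (norm_nonneg _)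
        rw [mulVec, dotProduct, Finset.sum_mul]
        refine (norm_sum_le _ _).trans (Finset.sum_le_sum fun j _ => ?_)
        rw [norm_mul]
        exact mul_le_mul_of_nonneg_left (norm_le_pi_norm v j) (norm_nonneg _)
    _ = _ := by ring

/-- A Hermitian matrix is dominated by a multiple of any positive definite matrix. -/
theorem exists_le_real_smul {M N : Mat 𝕜 n} (hM : M.PosDef) (hN : N.IsHermitian) :
    ∃ t : ℝ, 1 ≤ t ∧ N ≤ t • M := by
  obtain ⟨c, hc, h⟩ := exists_norm_sq_le_quad hM
  set K := ∑ i, ∑ j, ‖N i j‖ with hK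
  have hK0 : 0 ≤ K := by positivity
  refine ⟨1 + K * c, le_add_of_nonneg_right (by positivity), sub_nonneg.1 ?_⟩
  refine nonneg_of_quad ?_ fun v => ?_
  · refine IsHermitian.sub ?_ hN
    rw [IsHermitian, conjTranspose_smul, star_trivial, hM.isHermitian.eq]
  · rw [quad_sub, quad_real_smul]
    have h1 := quad_le_norm_sq N v
    have h2 := mul_le_mul_of_nonneg_left (h v) hK0
    have h3 := quad_nonneg (nonneg_of_posDef hM) v
    nlinarith

theorem real_smul_inv {t : ℝ} (ht : t ≠ 0) {M : Mat 𝕜 n} (hM : IsUnit M) :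
    (t • M)⁻¹ = t⁻¹ • M⁻¹ := by
  refine inv_eq_right_inv ?_
  rw [smul_mul_assoc, mul_smul_comm, smul_smul, mul_inv_cancel₀ ht, one_smul, mul_inv_of_isUnit hM]

/-- A two-cycle `Y ≤ X` of `X ↦ Q + Aᴴ f(X)⁻¹ A` is a fixed point. -/
theorem le_of_two_cycle {f : Mat 𝕜 n → Mat 𝕜 n} (hf : IsAdmissible f) (hfc : Continuous f)
    {A Q X Y : Mat 𝕜 n} (hQ : Q.PosDef) (hX : X.PosDef) (hY : Y.PosDef)
    (hXY : X = Q + Aᴴ * (f Y)⁻¹ * A) (hYX : Y = Q + Aᴴ * (f X)⁻¹ * A) : X ≤ Y := by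
  obtain ⟨t₀, ht₀, hXt⟩ := exists_le_real_smul hY hX.isHermitian
  obtain ⟨d, hd, hYd⟩ := exists_le_real_smul hQ hY.isHermitian
  have hd0 : 0 < d := by linarith
  have hdQ : d⁻¹ • Y ≤ Q := by
    have := real_smul_mono (inv_nonneg.2 hd0.le) hYd
    rwa [smul_smul, inv_mul_cancel₀ hd0.ne', one_smul] at this
  -- Through f and inversion, X ≤ (1 + u) Y gives X - Q ≤ (1 + u)(Y - Q), so X ≤ (1 + u) Y - u Q,
  -- and Q ≥ d⁻¹ Y shrinks the excess u by the factor 1 - d⁻¹. Continuity of f enters through real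
  -- homogeneity.
  have key : ∀ u : ℝ, 0 ≤ u → X ≤ (1 + u) • Y → X ≤ (1 + (1 - d⁻¹) * u) • Y := by
    intro u hu h
    have hu1 : 0 < 1 + u := by linarith
    have h1 := hf.mono h
    rw [hf.map_real_smul hfc] at h1
    have h2 := inv_anti (hf.posDef hX) h1
    rw [real_smul_inv hu1.ne' (hf.posDef hY).isUnit] at h2
    have h3 := real_smul_mono hu1.le (conj_mono h2 A)
    rw [mul_smul_comm, smul_mul_assoc, smul_smul, mul_inv_cancel₀ hu1.ne', one_smul,
      eq_sub_of_add_eq' hXY.symm, eq_sub_of_add_eq' hYX.symm] at h3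
    have h4 := add_le_add h3 (real_smul_mono hu hdQ)
    have h5 : X ≤ (1 + u) • (Y - Q) + u • Q - u • d⁻¹ • Y + Q := by
      have h6 := add_le_add_left h4 (Q - u • d⁻¹ • Y)
      have e1 : X - Q + u • d⁻¹ • Y + (Q - u • d⁻¹ • Y) = X := by abel
      have e2 : (1 + u) • (Y - Q) + u • Q + (Q - u • d⁻¹ • Y) =
        (1 + u) • (Y - Q) + u • Q - u • d⁻¹ • Y + Q := by abel
      rwa [e1, e2] at h6
    refine h5.trans (le_of_eq ?_)
    module
  have hq0 : 0 ≤ 1 - d⁻¹ := sub_nonneg.2 (inv_le_one_of_one_le₀ hd)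
  have hq1 : 1 - d⁻¹ < 1 := sub_lt_self _ (inv_pos.2 hd0)
  have hiter : ∀ k : ℕ, X ≤ (1 + (1 - d⁻¹) ^ k * (t₀ - 1)) • Y := by
    intro k
    induction k with
    | zero => simpa using hXt
    | succ k ih =>
      have h1 := key _ (mul_nonneg (pow_nonneg hq0 k) (sub_nonneg.2 ht₀)) ih
      rwa [← mul_assoc, ← pow_succ'] at h1
  have hlim : Tendsto (fun k : ℕ => (1 + (1 - d⁻¹) ^ k * (t₀ - 1)) • Y) atTop
      (𝓝 ((1 + 0 * (t₀ - 1)) • Y)) :=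
    (((tendsto_pow_atTop_nhds_zero_of_lt_one hq0 hq1).mul_const _).const_add 1).smul_const Y
  rw [zero_mul, add_zero, one_smul] at hlim
  exact le_of_tendsto_matrix tendsto_const_nhds hlim hiter

/-! ### Reduction to the standard equation and the maximal pair. -/

variable {f : Mat 𝕜 n → Mat 𝕜 n} {s : ℤˣ} {A Q X Y : Mat 𝕜 n}

theorem units_smul_smul_self (s : ℤˣ) (M : Mat 𝕜 n) : s • s • M = M := by
  rw [smul_smul, Int.units_mul_self, one_smul]

theorem IsAdmissible.map_units_smul (hf : IsAdmissible f) (s : ℤˣ) (M : Mat 𝕜 n) :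
    f (s • M) = s • f M := by
  rcases Int.units_eq_one_or s with rfl | rfl
  · rw [one_smul, one_smul]
  · rw [Units.neg_smul, Units.neg_smul, one_smul, one_smul, hf.map_neg]

theorem map_primalMap (hf : IsAdmissible f) (hX : IsUnit X) :
    f (primalMap s f A Q X) = f Q - s • ((f A)ᴴ * X⁻¹ * f A) := by
  rw [primalMap, hf.map_sub, hf.map_units_smul, hf.map_mul, hf.map_mul, hf.map_conjTranspose,
    hf.map_inv (hf.isUnit_map hX), hf.period_two]

/-- X - B⁽¹⁾ and f applied to F X are complementary Schur complements of one block matrix with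
diagonal blocks X and f Q. -/
theorem isUnit_sub_initial_B (hf : IsAdmissible f) (hX : IsUnit X) (hQ : IsUnit Q)
    (hF : IsUnit (primalMap s f A Q X)) : IsUnit (X - (initial s f A Q).B) := by
  have h := schur_isUnit (X := X) (N := f Q) (U := s • f A) (V := (f A)ᴴ) hX (hf.isUnit_map hQ) (by
    rw [mul_smul_comm, ← map_primalMap hf hX]
    exact hf.isUnit_map hF)
  rwa [smul_mul_assoc, smul_mul_assoc] at h

/-- The square of the fixed-point map is, up to a translation, the map of a standard equation. -/
theorem primalMap_primalMap (hf : IsAdmissible f) (hQh : Q.IsHermitian) (hX : IsUnit X)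
    (hQ : IsUnit Q) (hF : IsUnit (primalMap s f A Q X)) :
    primalMap s f A Q (primalMap s f A Q X) - (initial s f A Q).B =
      stdMap (initial s f A Q).A ((initial s f A Q).Q - (initial s f A Q).B)
        (X - (initial s f A Q).B) := by
  have hB := isUnit_sub_initial_B hf hX hQ hF
  -- Woodbury expands the inverse of f (F X) around (f Q)⁻¹ with middle factor (X - B⁽¹⁾)⁻¹. Its
  -- correction carries s, which meets the outer s, so s² = 1 leaves a minus sign in both cases.
  have h := schur_inv (X := f Q) (N := X) (U := s • (f A)ᴴ) (V := f A) (hf.isUnit_map hQ) hX (by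
    rw [mul_smul_comm]
    exact hB)
  rw [smul_mul_assoc, smul_mul_assoc, ← map_primalMap hf hX, mul_smul_comm, mul_smul_comm] at h
  have hQi : (f Q)⁻¹ᴴ = (f Q)⁻¹ := (hf.isHermitian hQh).inv.eq
  have hB' : X - s • (f A * (f Q)⁻¹ * (f A)ᴴ) = X - (initial s f A Q).B := rfl
  rw [hB'] at h
  rw [primalMap, h, stdMap]
  generalize (X - (initial s f A Q).B)⁻¹ = W
  simp only [initial, conjTranspose_mul, hQi]
  simp only [mul_add, add_mul, smul_add, mul_smul_comm, smul_mul_assoc, units_smul_smul_self,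
    Matrix.mul_assoc]
  abel

theorem initial_B_isHermitian (hf : IsAdmissible f) (hQ : Q.IsHermitian) :
    (initial s f A Q).B.IsHermitian := by
  have h : (f A * (f Q)⁻¹ * (f A)ᴴ).IsHermitian :=
    isHermitian_mul_mul_conjTranspose _ (hf.isHermitian hQ).inv
  rcases Int.units_eq_one_or s with rfl | rfl
  · simpa [initial] using h
  · simpa [initial, Units.neg_smul] using h.neg

theorem initial_B_nonneg (hf : IsAdmissible f) (hQ : Q.PosDef) : 0 ≤ (initial 1 f A Q).B := by
  simpa [initial] using conj_nonneg' (nonneg_of_posDef (hf.posDef hQ).inv) (f A)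

theorem neg_initial_B_nonneg (hf : IsAdmissible f) (hQ : Q.PosDef) :
    0 ≤ -(initial (-1) f A Q).B := by
  simpa [initial, Units.neg_smul] using conj_nonneg' (nonneg_of_posDef (hf.posDef hQ).inv) (f A)

theorem primalMap_neg_one (A Q X : Mat 𝕜 n) :
    primalMap (-1) f A Q X = Q + Aᴴ * (f X)⁻¹ * A := by
  simp [primalMap, Units.neg_smul]

theorem primalMap_one (A Q X : Mat 𝕜 n) :
    primalMap 1 f A Q X = Q - Aᴴ * (f X)⁻¹ * A := by
  simp [primalMap]

theorem le_primalMap_neg_one (hf : IsAdmissible f) (hX : X.PosDef) (A Q : Mat 𝕜 n) :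
    Q ≤ primalMap (-1) f A Q X := by
  rw [primalMap_neg_one]
  exact le_add_of_nonneg_right (conj_nonneg (nonneg_of_posDef (hf.posDef hX).inv) A)

theorem primalMap_one_le (hf : IsAdmissible f) (hX : X.PosDef) (A Q : Mat 𝕜 n) :
    primalMap 1 f A Q X ≤ Q := by
  rw [primalMap_one]
  exact sub_le_self _ (conj_nonneg (nonneg_of_posDef (hf.posDef hX).inv) A)

theorem primalMap_one_mono (hf : IsAdmissible f) (hX : X.PosDef) (h : X ≤ Y) (A Q : Mat 𝕜 n) :
    primalMap 1 f A Q X ≤ primalMap 1 f A Q Y := by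
  rw [primalMap_one, primalMap_one]
  exact sub_le_sub_left (conj_mono (inv_anti (hf.posDef hX) (hf.mono h)) A) Q

theorem primalMap_posDef (hf : IsAdmissible f) (hQ : Q.PosDef) (hX : X.PosDef)
    (hB : (X - (initial s f A Q).B).PosDef) : (primalMap s f A Q X).PosDef := by
  rcases Int.units_eq_one_or s with rfl | rfl
  · refine hf.posDef_of_map ?_
    rw [map_primalMap hf hX.isUnit, one_smul]
    have h := schur_posDef (V := (f A)ᴴ) (hf.posDef hQ) hX (by
      simpa [initial] using hB)
    simpa using h
  · exact posDef_of_le hQ (le_primalMap_neg_one hf hX A Q)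

theorem sub_initial_B_posDef (hf : IsAdmissible f) (hQ : Q.PosDef) (hX : X.PosDef)
    (hF : (primalMap s f A Q X).PosDef) : (X - (initial s f A Q).B).PosDef := by
  rcases Int.units_eq_one_or s with rfl | rfl
  · have h := hf.posDef hF
    rw [map_primalMap hf hX.isUnit, one_smul] at h
    simpa [initial] using schur_posDef hX (hf.posDef hQ) h
  · rw [sub_eq_add_neg]
    exact posDef_of_le hX (le_add_of_nonneg_right (neg_initial_B_nonneg hf hQ))

/-- A positive definite subsolution of the squared fixed-point map yields the maximal solution. -/
theorem exists_isMaximalSolution (hf : IsAdmissible f) (hfc : Continuous f) (hQ : Q.PosDef)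
    (hX : X.PosDef) (hXB : (X - (initial s f A Q).B).PosDef)
    (hsub : X - (initial s f A Q).B ≤
      stdMap (initial s f A Q).A ((initial s f A Q).Q - (initial s f A Q).B)
        (X - (initial s f A Q).B)) :
    ∃ M, IsMaximalSolution f (primalMap s f A Q) M ∧
      IsStdMax (initial s f A Q).A ((initial s f A Q).Q - (initial s f A Q).B)
        (M - (initial s f A Q).B) := by
  obtain ⟨D, hXD, hD⟩ := exists_isStdMax hXB hsub
  obtain ⟨M, rfl⟩ : ∃ M, D = M - (initial s f A Q).B := ⟨D + (initial s f A Q).B, by abel⟩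
  have hM : M.PosDef := posDef_of_le hX (by simpa using hXD)
  have hF := primalMap_posDef hf hQ hM hD.posDef
  have hFF : primalMap s f A Q (primalMap s f A Q M) = M := by
    have h1 := primalMap_primalMap hf hQ.isHermitian hM.isUnit hQ.isUnit hF.isUnit
    rw [← hD.eq] at h1
    exact sub_left_injective h1
  have hBh := initial_B_isHermitian (s := s) (A := A) hf hQ.isHermitian
  have hmax : ∀ Z : Mat 𝕜 n, Z.IsHermitian → IsUnit Z → IsUnit (primalMap s f A Q Z) →
      primalMap s f A Q (primalMap s f A Q Z) = Z → Z ≤ M := by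
    intro Z hZ hZu hFZ hZZ
    have h1 := primalMap_primalMap hf hQ.isHermitian hZu hQ.isUnit hFZ
    rw [hZZ] at h1
    have h2 := hD.max _ (hZ.sub hBh) (isUnit_sub_initial_B hf hZu hQ.isUnit hFZ) h1
    simpa using h2
  -- F M is also fixed by F ∘ F, so it lies below the maximal such point. Applying the increasing F
  -- (s = 1), or the two-cycle lemma (s = -1), reverses this.
  have hFM : primalMap s f A Q M ≤ M :=
    hmax _ hF.isHermitian hF.isUnit (by rw [hFF]; exact hM.isUnit) (by rw [hFF])
  have hMF : M ≤ primalMap s f A Q M := by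
    rcases Int.units_eq_one_or s with rfl | rfl
    · have h1 := primalMap_one_mono hf hF hFM A Q
      rwa [hFF] at h1
    · refine le_of_two_cycle hf hfc hQ hM hF ?_ (primalMap_neg_one A Q M)
      rw [← primalMap_neg_one, hFF]
  have hfix : M = primalMap s f A Q M := le_antisymm hMF hFM
  refine ⟨M, ⟨hM, ⟨hM.isHermitian, hf.isUnit_map hM.isUnit, hfix⟩, fun Z hZ => ?_⟩, hD⟩
  obtain ⟨hZh, hZu, hZs⟩ := hZ
  have hZu' := hf.isUnit_of_map hZu
  exact hmax Z hZh hZu' (by rwa [← hZs]) (by rw [← hZs, ← hZs])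

/-- For s = 1 the map F is increasing, so X ≤ F X passes to X ≤ F (F X). -/
theorem exists_isMaximalSolution_of_subsolution (hf : IsAdmissible f) (hfc : Continuous f)
    (hX : X ∈ subsolutions f A Q) :
    Q.PosDef ∧ ∃ M, IsMaximalSolution f (primalMap 1 f A Q) M ∧
      IsStdMax (initial 1 f A Q).A ((initial 1 f A Q).Q - (initial 1 f A Q).B)
        (M - (initial 1 f A Q).B) := by
  obtain ⟨hXp, hXs⟩ := hX
  have hXF : X ≤ primalMap 1 f A Q X := hXs
  have hQ : Q.PosDef := posDef_of_le hXp (hXF.trans (primalMap_one_le hf hXp A Q))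
  have hF := posDef_of_le hXp hXF
  have hB := sub_initial_B_posDef hf hQ hXp hF
  refine ⟨hQ, exists_isMaximalSolution hf hfc hQ hXp hB ?_⟩
  rw [← primalMap_primalMap hf hQ.isHermitian hXp.isUnit hQ.isUnit hF.isUnit]
  exact sub_le_sub_right (hXF.trans (primalMap_one_mono hf hXp hXF A Q)) _

/-- For s = -1, F sends positive definite matrices above Q, so Q itself is a subsolution of F ∘ F.
-/
theorem exists_isMaximalSolution_neg_one (hf : IsAdmissible f) (hfc : Continuous f)
    (hQ : Q.PosDef) (A : Mat 𝕜 n) :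
    ∃ M, IsMaximalSolution f (primalMap (-1) f A Q) M ∧
      IsStdMax (initial (-1) f A Q).A ((initial (-1) f A Q).Q - (initial (-1) f A Q).B)
        (M - (initial (-1) f A Q).B) := by
  have hF := posDef_of_le hQ (le_primalMap_neg_one hf hQ A Q)
  refine exists_isMaximalSolution hf hfc hQ hQ (sub_initial_B_posDef hf hQ hQ hF) ?_
  rw [← primalMap_primalMap hf hQ.isHermitian hQ.isUnit hQ.isUnit hF.isUnit]
  exact sub_le_sub_right (le_primalMap_neg_one hf hF A Q) _

theorem dualMap_eq_primalMap (s : ℤˣ) (f : Mat 𝕜 n → Mat 𝕜 n) (A Q : Mat 𝕜 n) :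
    dualMap s f A Q = primalMap s f (f A)ᴴ Q := by
  funext Y
  rw [dualMap, primalMap, conjTranspose_conjTranspose]

/-- The initial triple of the dual equation is dual to the one of the original equation. -/
theorem initial_dual (hf : IsAdmissible f) (hQ : Q.IsHermitian) :
    initial s f (f A)ᴴ Q = dualTriple Q (initial s f A Q) := by
  have hQi : (f Q)⁻¹ᴴ = (f Q)⁻¹ := (hf.isHermitian hQ).inv.eq
  have hA : f (f A)ᴴ = Aᴴ := by rw [hf.map_conjTranspose, hf.period_two]
  apply Triple.ext
  · simp only [initial, dualTriple, hA, conjTranspose_mul, hQi, Matrix.mul_assoc]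
  · simp only [initial, dualTriple, hA, conjTranspose_conjTranspose, sub_sub_cancel]
  · simp only [initial, dualTriple, conjTranspose_conjTranspose]

/-- The maximal solutions of the equation and of its dual. -/
theorem exists_maximal_pair (hf : IsAdmissible f) (hfc : Continuous f)
    (h : (s = 1 ∧ (subsolutions f A Q).Nonempty) ∨ (s = -1 ∧ Q.PosDef)) :
    Q.PosDef ∧ ∃ X Y, IsMaximalSolution f (primalMap s f A Q) X ∧
      IsMaximalSolution f (dualMap s f A Q) Y ∧
      IsStdMax (initial s f A Q).A ((initial s f A Q).Q - (initial s f A Q).B)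
        (X - (initial s f A Q).B) ∧
      IsStdMax (initial s f A Q).Aᴴ ((initial s f A Q).Q - (initial s f A Q).B)
        (Y - (Q - (initial s f A Q).Q)) := by
  suffices key : Q.PosDef ∧ ∃ X Y, IsMaximalSolution f (primalMap s f A Q) X ∧
      IsMaximalSolution f (primalMap s f (f A)ᴴ Q) Y ∧
      IsStdMax (initial s f A Q).A ((initial s f A Q).Q - (initial s f A Q).B)
        (X - (initial s f A Q).B) ∧
      IsStdMax (initial s f (f A)ᴴ Q).A
        ((initial s f (f A)ᴴ Q).Q - (initial s f (f A)ᴴ Q).B)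
        (Y - (initial s f (f A)ᴴ Q).B) by
    obtain ⟨hQ, X, Y, hX, hY, hX', hY'⟩ := key
    refine ⟨hQ, X, Y, hX, by rwa [dualMap_eq_primalMap], hX', ?_⟩
    rw [initial_dual hf hQ.isHermitian] at hY'
    simpa only [dualTriple, sub_sub_sub_cancel_left] using hY'
  rcases h with ⟨rfl, X₀, hX₀⟩ | ⟨rfl, hQ⟩
  · obtain ⟨hQ, X, hX, hX'⟩ := exists_isMaximalSolution_of_subsolution hf hfc hX₀
    -- The hypothesis for s = 1 is not symmetric under duality, so the dual subsolution is taken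
    -- from the dual standard equation and translated back by the dual B⁽¹⁾.
    obtain ⟨Z, hZ, hZs⟩ := exists_dual_std_solution hX'.posDef hX'.eq
    set E := initial 1 f (f A)ᴴ Q with hE
    have hEA : E.A = (initial 1 f A Q).Aᴴ := by rw [hE, initial_dual hf hQ.isHermitian]; rfl
    have hER : E.Q - E.B = (initial 1 f A Q).Q - (initial 1 f A Q).B := by
      rw [hE, initial_dual hf hQ.isHermitian]
      simp only [dualTriple, sub_sub_sub_cancel_left]
    have hZE : Z + E.B - E.B = Z := add_sub_cancel_right Z E.B
    obtain ⟨Y, hY, hY'⟩ := exists_isMaximalSolution (s := 1) (A := (f A)ᴴ) (X := Z + E.B) hf hfc hQ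
      (posDef_of_le hZ (le_add_of_nonneg_right (initial_B_nonneg hf hQ)))
      (by rw [← hE, hZE]; exact hZ)
      (by rw [← hE, hZE, hEA, hER]; exact hZs.le)
    exact ⟨hQ, X, Y, hX, hY, hX', hY'⟩
  · obtain ⟨X, hX, hX'⟩ := exists_isMaximalSolution_neg_one hf hfc hQ A
    obtain ⟨Y, hY, hY'⟩ := exists_isMaximalSolution_neg_one hf hfc hQ (f A)ᴴ
    exact ⟨hQ, X, Y, hX, hY, hX', hY'⟩

end MatrixEq

theorem theorem4p1 {𝕜 : Type*} [RCLike 𝕜] {n : ℕ}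
    (f : MatrixEq.Mat 𝕜 n → MatrixEq.Mat 𝕜 n) (hf : MatrixEq.IsAdmissible f)
    (hfc : Continuous f)
    (A Q : MatrixEq.Mat 𝕜 n) (hQ : Q.IsHermitian) (s : ℤˣ)
    (h : (s = 1 ∧ (MatrixEq.subsolutions f A Q).Nonempty) ∨
      (s = -1 ∧ IsUnit A ∧ Q.PosDef))
    (r : ℕ) (hr : 2 ≤ r) :
    MatrixEq.WellDefined s f A Q r ∧
    ∃ XM YM : MatrixEq.Mat 𝕜 n,
      MatrixEq.IsMaximalSolution f (MatrixEq.primalMap s f A Q) XM ∧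
      MatrixEq.IsMaximalSolution f (MatrixEq.dualMap s f A Q) YM ∧
      (MatrixEq.specRadius (MatrixEq.closedLoop s f A Q XM) = 1 →
        MatrixEq.ConvergesRLinearly (fun k => (MatrixEq.accel s f A Q r k).A) 0 (1 / r) ∧
        MatrixEq.ConvergesRLinearly (fun k => (MatrixEq.accel s f A Q r k).Q) XM (1 / r) ∧
        MatrixEq.ConvergesRLinearly (fun k => (MatrixEq.accel s f A Q r k).B) (Q - YM)
          (1 / r)) := by
  obtain ⟨hQp, X, Y, hX, hY, hX', hY'⟩ := MatrixEq.exists_maximal_pair (s := s) hf hfc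
    (h.imp_right fun h => ⟨h.1, h.2.2⟩)
  obtain ⟨hu, hc⟩ := MatrixEq.accel_converges hr hX' hY'
  exact ⟨⟨hf.isUnit_map hQp.isUnit, fun k i _ => hu k i⟩, X, Y, hX, hY, fun _ => hc⟩
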